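/- Let $N\ge 1$. For an integrable potential $V=V^*\in L^1(0,1)$ with values in the $N\times N$ complex matrices, let $H$ be the self-adjoint operator $H\psi=-\psi''+V\psi$ in $L^2(0,1)^N$ with boundary conditions $\psi(0)=\psi(1)=0$, let $\lambda_1<\lambda_2<\dots$ be its distinct eigenvalues, and let $k_\alpha$ be the multiplicity of $\lambda_\alpha$. Let $\varphi(x,\lambda)$ be the $N\times N$ matrix-valued solution of $-\varphi''+V\varphi=\lambda\varphi$ with $\varphi(0,\lambda)=0$, $\varphi'(0,\lambda)=I$. For $\alpha\ge 1$ put $$S_\alpha=\int_0^1\varphi(t,\lambda_\alpha)^*\varphi(t,\lambda_\alpha)\,dt,\qquad \mathcal E_\alpha=\operatorname{Ker}\varphi(1,\lambda_\alpha)\subset\mathbb C^N,$$ and let the forbidden subspace $\mathcal F_\alpha=\mathbb C^N\ominus S_\alpha(\mathcal E_\alpha)$ be the orthogonal complement of $S_\alpha(\mathcal E_\alpha)$ in $\mathbb C^N$. Quantities that belong to another potential $\widetilde V$ carry a tilde. Let $V=V^*\in L^1(0,1)$, and let $\widetilde V=\widetilde V^*\in L^1(0,1)$ be isospectral to $V$,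 i.e. $\widetilde\lambda_\beta=\lambda_\beta$ and $\widetilde k_\beta=k_\beta$ for all $\beta\ge 1$. Fix $\alpha\ge 1$ and suppose that $\widetilde{\mathcal E}_\beta=\mathcal E_\beta$ for all $\beta\ne\alpha$. Then $$\widetilde{\mathcal F}_\alpha=\mathcal F_\alpha\qquad\text{and}\qquad \widetilde{\mathcal E}_\alpha\cap\mathcal F_\alpha=\{0\}.$$ In particular, $\mathcal F_\alpha$ is determined by the spectrum (with multiplicities) together with the subspaces $\mathcal E_\beta$, $\beta\ne\alpha$. -/

import Mathlib

open MeasureTheory Set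
open scoped Matrix

noncomputable section

namespace MatrixSchrodinger

variable {N : ℕ}

/-- `V = V* ∈ L¹(0,1)`: the function `V` (its values off `(0,1)` are irrelevant) represents an
integrable Hermitian `N × N` matrix potential on `(0,1)`. -/
def IsPotential (V : ℝ → Matrix (Fin N) (Fin N) ℂ) : Prop :=
  (∀ i j, IntegrableOn (fun x => V x i j) (Ioo 0 1)) ∧
    ∀ᵐ x ∂(volume.restrict (Ioo (0 : ℝ) 1)), (V x).IsHermitian

/-- The right-hand side of `ψ'' = V ψ - lam ψ`. -/
def rhs (V : ℝ → Matrix (Fin N) (Fin N) ℂ) (lam : ℂ)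
    (ψ : ℝ → EuclideanSpace ℂ (Fin N)) (t : ℝ) : EuclideanSpace ℂ (Fin N) :=
  Matrix.toEuclideanLin (V t) (ψ t) - lam • ψ t

/-- `ψ` solves `-ψ'' + V ψ = lam ψ` on `[0,1]` and `p` is its derivative. As usual for an
integrable coefficient this means: `ψ` is continuously differentiable with `ψ' = p`, `p` is
absolutely continuous, and `p' = V ψ - lam ψ` almost everywhere; both relations are written in
integrated form. -/
structure IsSolution (V : ℝ → Matrix (Fin N) (Fin N) ℂ) (lam : ℂ)
    (ψ p : ℝ → EuclideanSpace ℂ (Fin N)) : Prop where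
  continuousOn_deriv : ContinuousOn p (Icc 0 1)
  integrable_rhs : IntervalIntegrable (rhs V lam ψ) volume 0 1
  eq_integral : ∀ x ∈ Icc (0 : ℝ) 1, ψ x = ψ 0 + ∫ t in (0 : ℝ)..x, p t
  deriv_eq_integral : ∀ x ∈ Icc (0 : ℝ) 1, p x = p 0 + ∫ t in (0 : ℝ)..x, rhs V lam ψ t

/-- `Φ` is the `N × N` matrix solution of `-Φ'' + V Φ = lam Φ` on `[0,1]` with
`Φ(0) = 0` and `Φ'(0) = I`. The matrix equation is expressed by applying it to all vectors. -/
def IsDirichletSolution (V : ℝ → Matrix (Fin N) (Fin N) ℂ) (lam : ℂ)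
    (Φ : ℝ → Matrix (Fin N) (Fin N) ℂ) : Prop :=
  ∃ P : ℝ → Matrix (Fin N) (Fin N) ℂ,
    (∀ h : EuclideanSpace ℂ (Fin N),
      IsSolution V lam (fun x => Matrix.toEuclideanLin (Φ x) h)
        (fun x => Matrix.toEuclideanLin (P x) h)) ∧
    Φ 0 = 0 ∧ P 0 = 1

/-- The matrix solution `φ(x, lam, V)`. For a potential `V` it exists and is unique on `[0,1]`;
only its values on `[0,1]` are used. -/
def phi (V : ℝ → Matrix (Fin N) (Fin N) ℂ) (lam : ℂ) : ℝ → Matrix (Fin N) (Fin N) ℂ :=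
  Classical.epsilon (IsDirichletSolution V lam)

theorem IsSolution.zero (V : ℝ → Matrix (Fin N) (Fin N) ℂ) (lam : ℂ) :
    IsSolution V lam (0 : ℝ → EuclideanSpace ℂ (Fin N)) 0 := by
  have h : rhs V lam (0 : ℝ → EuclideanSpace ℂ (Fin N)) = 0 := by
    funext t; simp [rhs]
  refine ⟨continuousOn_const, ?_, ?_, ?_⟩
  · rw [h]; exact intervalIntegrable_const
  · intro x _; simp
  · intro x _; rw [h]; simp

theorem IsSolution.add {V : ℝ → Matrix (Fin N) (Fin N) ℂ} {lam : ℂ}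
    {ψ p χ q : ℝ → EuclideanSpace ℂ (Fin N)}
    (h₁ : IsSolution V lam ψ p) (h₂ : IsSolution V lam χ q) :
    IsSolution V lam (ψ + χ) (p + q) := by
  have h : rhs V lam (ψ + χ) = rhs V lam ψ + rhs V lam χ := by
    funext t; simp only [rhs, Pi.add_apply, map_add, smul_add]; abel
  have sub : ∀ x ∈ Icc (0 : ℝ) 1, uIcc 0 x ⊆ uIcc (0 : ℝ) 1 := fun x hx => by
    rw [uIcc_of_le hx.1, uIcc_of_le zero_le_one]; exact Icc_subset_Icc_right hx.2
  have hp : IntervalIntegrable p volume 0 1 :=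
    ContinuousOn.intervalIntegrable (by rw [uIcc_of_le zero_le_one]; exact h₁.1)
  have hq : IntervalIntegrable q volume 0 1 :=
    ContinuousOn.intervalIntegrable (by rw [uIcc_of_le zero_le_one]; exact h₂.1)
  refine ⟨h₁.1.add h₂.1, ?_, ?_, ?_⟩
  · rw [h]; exact h₁.2.add h₂.2
  · intro x hx
    have := intervalIntegral.integral_add (hp.mono_set (sub x hx)) (hq.mono_set (sub x hx))
    simp only [Pi.add_apply]
    rw [this, h₁.3 x hx, h₂.3 x hx]; abel
  · intro x hx
    have := intervalIntegral.integral_add (h₁.2.mono_set (sub x hx)) (h₂.2.mono_set (sub x hx))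
    rw [h]
    simp only [Pi.add_apply]
    rw [this, h₁.4 x hx, h₂.4 x hx]; abel

theorem IsSolution.smul {V : ℝ → Matrix (Fin N) (Fin N) ℂ} {lam : ℂ}
    {ψ p : ℝ → EuclideanSpace ℂ (Fin N)} (c : ℂ) (h₁ : IsSolution V lam ψ p) :
    IsSolution V lam (c • ψ) (c • p) := by
  have h : rhs V lam (c • ψ) = c • rhs V lam ψ := by
    funext t
    simp only [rhs, Pi.smul_apply, map_smul, smul_sub]
    rw [smul_comm]
  refine ⟨h₁.1.const_smul c, ?_, ?_, ?_⟩
  · rw [h]; exact h₁.2.smul c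
  · intro x hx
    simp only [Pi.smul_apply]
    rw [intervalIntegral.integral_smul, h₁.3 x hx, smul_add]
  · intro x hx
    rw [h]
    simp only [Pi.smul_apply]
    rw [intervalIntegral.integral_smul, h₁.4 x hx, smul_add]

/-- The space of solutions of `-ψ'' + V ψ = lam ψ`, `ψ(0) = ψ(1) = 0`, that is, the
eigenfunctions (and `0`) of the Dirichlet operator `H` for the number `lam`. A function on `[0,1]`
is represented by its extension by zero to the line. -/
def eigenspace (V : ℝ → Matrix (Fin N) (Fin N) ℂ) (lam : ℂ) :
    Submodule ℂ (ℝ → EuclideanSpace ℂ (Fin N)) where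
  carrier := {ψ | (∀ x, x ∉ Icc (0 : ℝ) 1 → ψ x = 0) ∧ ψ 0 = 0 ∧ ψ 1 = 0 ∧
    ∃ p, IsSolution V lam ψ p}
  zero_mem' := ⟨fun _ _ => rfl, rfl, rfl, 0, IsSolution.zero V lam⟩
  add_mem' := by
    rintro ψ χ ⟨h₁, h₂, h₃, p, hp⟩ ⟨k₁, k₂, k₃, q, hq⟩
    exact ⟨fun x hx => by simp [h₁ x hx, k₁ x hx], by simp [h₂, k₂], by simp [h₃, k₃],
      p + q, hp.add hq⟩
  smul_mem' := by
    rintro c ψ ⟨h₁, h₂, h₃, p, hp⟩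
    exact ⟨fun x hx => by simp [h₁ x hx], by simp [h₂], by simp [h₃], c • p, hp.smul c⟩

/-- The set of eigenvalues of the self-adjoint operator `H`. -/
def eigenvalues (V : ℝ → Matrix (Fin N) (Fin N) ℂ) : Set ℝ :=
  {μ | eigenspace V (μ : ℂ) ≠ ⊥}

/-- The distinct eigenvalues in increasing order, indexed from `0`: the smallest eigenvalue, and
then repeatedly the next one. -/
def eigenvalue (V : ℝ → Matrix (Fin N) (Fin N) ℂ) : ℕ → ℝ
  | 0 => sInf (eigenvalues V)
  | n + 1 => sInf {μ | μ ∈ eigenvalues V ∧ eigenvalue V n < μ}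

/-- The multiplicity `k_α` of the eigenvalue with index `α`. -/
def eigenvalueMultiplicity (V : ℝ → Matrix (Fin N) (Fin N) ℂ) (α : ℕ) : ℕ :=
  Module.finrank ℂ (eigenspace V (eigenvalue V α : ℂ))

/-- The isospectral set `Iso(V)`. -/
def Iso (V : ℝ → Matrix (Fin N) (Fin N) ℂ) : Set (ℝ → Matrix (Fin N) (Fin N) ℂ) :=
  {W | IsPotential W ∧ ∀ α, eigenvalue W α = eigenvalue V α ∧
    eigenvalueMultiplicity W α = eigenvalueMultiplicity V α}

/-- `S_α = ∫₀¹ φ(t, λ_α)* φ(t, λ_α) dt`, entry by entry. -/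
def S (V : ℝ → Matrix (Fin N) (Fin N) ℂ) (α : ℕ) : Matrix (Fin N) (Fin N) ℂ :=
  Matrix.of fun i j => ∫ t in (0 : ℝ)..1,
    ((phi V (eigenvalue V α : ℂ) t)ᴴ * phi V (eigenvalue V α : ℂ) t) i j

/-- `E_α = Ker φ(1, λ_α)`. -/
def E (V : ℝ → Matrix (Fin N) (Fin N) ℂ) (α : ℕ) : Submodule ℂ (EuclideanSpace ℂ (Fin N)) :=
  LinearMap.ker (Matrix.toEuclideanLin (phi V (eigenvalue V α : ℂ) 1))

/-- The forbidden subspace `F_α = ℂ^N ⊖ S_α(E_α)`. -/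
def F (V : ℝ → Matrix (Fin N) (Fin N) ℂ) (α : ℕ) : Submodule ℂ (EuclideanSpace ℂ (Fin N)) :=
  ((E V α).map (Matrix.toEuclideanLin (S V α)))ᗮ

end MatrixSchrodinger

end

noncomputable section

namespace MatrixSchrodinger

open Filter Topology

/-! ### Primitives of integrable functions -/

section Primitives

variable {E F G : Type*} [NormedAddCommGroup E] [NormedSpace ℝ E]
  [NormedAddCommGroup F] [NormedSpace ℝ F] [NormedAddCommGroup G] [NormedSpace ℝ G]

/-! Write M(λ) = φ(1, λ) and D(λ) = φ'(1, λ), with tildes for the second potential, and let μ = λ_α.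
For h ∈ E_α the Lagrange identity becomes ⟨D(μ)h, M(λ)w⟩ = (λ − μ)⟨h, G(μ, λ)w⟩ with G(μ, λ) = ∫
φ(t, μ)* φ(t, λ) dt (`inner_dOp_mOp`). Hence the row ℓ = ⟨D(μ)h, ·⟩ satisfies ℓM(μ) = 0, and at
every other eigenvalue ℓM annihilates Ker M̃ = Ker M.

The poles of M̃⁻¹ are at most simple (`eventually_isUnit_mOp`), so ℓM(λ)M̃(λ)⁻¹ has only removable
singularities. Both M(z²) and M̃(z²) are comparable with sin z / z, so this quotient is bounded on
the boundaries of large squares in the plane of z = √λ. By the maximum principle and Liouville's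
theorem it is a constant row ℓ̃, that is, ℓM = ℓ̃M̃ (`exists_row_eq`).

At λ = μ the row ℓ̃ annihilates Ran M̃(μ), so ℓ̃ = ⟨D̃(μ)k, ·⟩ for some k ∈ Ẽ_α (`exists_dOp_eq`).
Applying the Lagrange identity on both sides, dividing by λ − μ and letting λ → μ gives S_α h = S̃_α
k. Thus S_α(E_α) ⊂ S̃_α(Ẽ_α) (`map_S_E_le`); the roles can be exchanged, so the orthogonal
complements agree. Since S̃_α is positive definite, a vector of Ẽ_α orthogonal to S̃_α(Ẽ_α) is zero
(`E_inf_F_eq_bot`). -/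

theorem absolutelyContinuousOnInterval_of_dist_le {X Y : Type*} [PseudoMetricSpace X]
    [PseudoMetricSpace Y] {f : ℝ → X} {g : ℝ → Y} {a b : ℝ}
    (hf : AbsolutelyContinuousOnInterval f a b)
    (h : ∀ x ∈ uIcc a b, ∀ y ∈ uIcc a b, dist (g x) (g y) ≤ dist (f x) (f y)) :
    AbsolutelyContinuousOnInterval g a b := by
  rw [absolutelyContinuousOnInterval_iff] at hf ⊢
  intro ε hε
  obtain ⟨δ, hδ, H⟩ := hf ε hε
  refine ⟨δ, hδ, fun I hI hI' => lt_of_le_of_lt (Finset.sum_le_sum fun i hi => ?_) (H I hI hI')⟩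
  exact h _ (hI.1 i hi).1 _ (hI.1 i hi).2

theorem intervalIntegrable_of_mem {X : Type*} [NormedAddCommGroup X] {f : ℝ → X}
    (hf : IntervalIntegrable f volume 0 1) {x y : ℝ}
    (hx : x ∈ Icc (0 : ℝ) 1) (hy : y ∈ Icc (0 : ℝ) 1) : IntervalIntegrable f volume x y := by
  refine hf.mono_set ?_
  rw [uIcc_of_le zero_le_one]
  exact uIcc_subset_Icc hx hy

theorem continuousOn_primitive_unit {f : ℝ → E} (hf : IntervalIntegrable f volume 0 1) :
    ContinuousOn (fun x => ∫ t in (0 : ℝ)..x, f t) (Icc 0 1) := by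
  have := intervalIntegral.continuousOn_primitive_interval' hf (a := 0) (by simp)
  rwa [uIcc_of_le zero_le_one] at this

theorem dist_primitive_le {f : ℝ → E} (hf : IntervalIntegrable f volume 0 1) {x y : ℝ}
    (hx : x ∈ Icc (0 : ℝ) 1) (hy : y ∈ Icc (0 : ℝ) 1) :
    ‖(∫ t in (0 : ℝ)..x, f t) - ∫ t in (0 : ℝ)..y, f t‖ ≤
      |(∫ t in (0 : ℝ)..x, ‖f t‖) - ∫ t in (0 : ℝ)..y, ‖f t‖| := by
  have h0 : (0 : ℝ) ∈ Icc (0 : ℝ) 1 := by simp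
  rw [intervalIntegral.integral_interval_sub_left (intervalIntegrable_of_mem hf h0 hx)
      (intervalIntegrable_of_mem hf h0 hy),
    intervalIntegral.integral_interval_sub_left (intervalIntegrable_of_mem hf.norm h0 hx)
      (intervalIntegrable_of_mem hf.norm h0 hy)]
  exact intervalIntegral.norm_integral_le_abs_integral_norm

theorem absolutelyContinuousOnInterval_primitive {f : ℝ → E}
    (hf : IntervalIntegrable f volume 0 1) :
    AbsolutelyContinuousOnInterval (fun x => ∫ t in (0 : ℝ)..x, f t) 0 1 := by
  refine absolutelyContinuousOnInterval_of_dist_le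
    (hf.norm.absolutelyContinuousOnInterval_intervalIntegral (c := 0) (by simp)) ?_
  rw [uIcc_of_le zero_le_one]
  intro x hx y hy
  rw [dist_eq_norm, Real.dist_eq]
  exact dist_primitive_le hf hx hy

theorem absolutelyContinuousOnInterval_bilinear {β : E × F → G} (hβ : IsBoundedBilinearMap ℝ β)
    {u : ℝ → E} {v : ℝ → F} (hu : AbsolutelyContinuousOnInterval u 0 1)
    (hv : AbsolutelyContinuousOnInterval v 0 1) :
    AbsolutelyContinuousOnInterval (fun x => β (u x, v x)) 0 1 := by
  obtain ⟨C, hC⟩ := hu.exists_bound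
  obtain ⟨D, hD⟩ := hv.exists_bound
  obtain ⟨M, hM, hβM⟩ := hβ.bound
  have hlim := (Tendsto.const_mul (M * D) hu).add (Tendsto.const_mul (M * C) hv)
  rw [mul_zero, mul_zero, add_zero] at hlim
  refine squeeze_zero' (Eventually.of_forall fun I => by positivity) ?_ hlim
  filter_upwards [mem_inf_of_right (mem_principal_self _)] with I hI
  rw [Finset.mul_sum, Finset.mul_sum, ← Finset.sum_add_distrib]
  refine Finset.sum_le_sum fun i hi => ?_
  obtain ⟨h1, h2⟩ := hI.1 i hi
  set x := (I.2 i).1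
  set y := (I.2 i).2
  have e : β (u x, v x) - β (u y, v y) = β (u x - u y, v x) + β (u y, v x - v y) := by
    rw [hβ.map_sub_left, hβ.map_sub_right]; abel
  rw [dist_eq_norm, e, dist_eq_norm, dist_eq_norm]
  refine (norm_add_le _ _).trans (add_le_add ?_ ?_)
  · refine (hβM _ _).trans ?_
    have := hD x h1
    calc M * ‖u x - u y‖ * ‖v x‖ ≤ M * ‖u x - u y‖ * D := by gcongr
      _ = _ := by ring
  · refine (hβM _ _).trans ?_
    have := hC y h2
    gcongr

/-- The product rule, in integrated form, for primitives of integrable functions. -/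
theorem bilinear_primitive [CompleteSpace E] [CompleteSpace F] [CompleteSpace G]
    {β : E × F → G} (hβ : IsBoundedBilinearMap ℝ β) {u a : ℝ → E} {v b : ℝ → F}
    (ha : IntervalIntegrable a volume 0 1) (hb : IntervalIntegrable b volume 0 1)
    (hu : ∀ x ∈ Icc (0 : ℝ) 1, u x = u 0 + ∫ t in (0 : ℝ)..x, a t)
    (hv : ∀ x ∈ Icc (0 : ℝ) 1, v x = v 0 + ∫ t in (0 : ℝ)..x, b t) :
    IntervalIntegrable (fun t => β (a t, v t) + β (u t, b t)) volume 0 1 ∧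
    ∀ x ∈ Icc (0 : ℝ) 1,
      β (u x, v x) = β (u 0, v 0) + ∫ t in (0 : ℝ)..x, (β (a t, v t) + β (u t, b t)) := by
  -- The functions u and v are controlled on [0,1] only. Their primitives are defined on the whole
  -- line and can be differentiated there.
  set U : ℝ → E := fun x => u 0 + ∫ t in (0 : ℝ)..x, a t with hU
  set W : ℝ → F := fun x => v 0 + ∫ t in (0 : ℝ)..x, b t with hW
  have hUac : AbsolutelyContinuousOnInterval U 0 1 :=
    absolutelyContinuousOnInterval_of_dist_le (absolutelyContinuousOnInterval_primitive ha)
      (fun x _ y _ => by simp [hU])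
  have hWac : AbsolutelyContinuousOnInterval W 0 1 :=
    absolutelyContinuousOnInterval_of_dist_le (absolutelyContinuousOnInterval_primitive hb)
      (fun x _ y _ => by simp [hW])
  have hUc := hUac.continuousOn
  have hWc := hWac.continuousOn
  have i1 : IntervalIntegrable (fun t => β (a t, W t)) volume 0 1 := by
    obtain ⟨M, hM, hβM⟩ := hβ.bound
    obtain ⟨C, hC⟩ := hWac.exists_bound
    refine IntervalIntegrable.mono_fun' (g := fun t => M * C * ‖a t‖)
      (ha.norm.const_mul _) ?_ ?_
    · refine hβ.continuous.comp_aestronglyMeasurable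
        (AEStronglyMeasurable.prodMk ha.aestronglyMeasurable_restrict_uIoc ?_)
      exact (hWc.mono uIoc_subset_uIcc).aestronglyMeasurable measurableSet_uIoc
    · refine (ae_restrict_mem measurableSet_uIoc).mono fun t ht => ?_
      refine (hβM _ _).trans ?_
      have := hC t (uIoc_subset_uIcc ht)
      calc M * ‖a t‖ * ‖W t‖ ≤ M * ‖a t‖ * C := by gcongr
        _ = _ := by ring
  have i2 : IntervalIntegrable (fun t => β (U t, b t)) volume 0 1 := by
    obtain ⟨M, hM, hβM⟩ := hβ.bound
    obtain ⟨C, hC⟩ := hUac.exists_bound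
    refine IntervalIntegrable.mono_fun' (g := fun t => M * C * ‖b t‖)
      (hb.norm.const_mul _) ?_ ?_
    · refine hβ.continuous.comp_aestronglyMeasurable
        (AEStronglyMeasurable.prodMk ?_ hb.aestronglyMeasurable_restrict_uIoc)
      exact (hUc.mono uIoc_subset_uIcc).aestronglyMeasurable measurableSet_uIoc
    · refine (ae_restrict_mem measurableSet_uIoc).mono fun t ht => ?_
      refine (hβM _ _).trans ?_
      have := hC t (uIoc_subset_uIcc ht)
      calc M * ‖U t‖ * ‖b t‖ ≤ M * C * ‖b t‖ := by gcongr
        _ = _ := rfl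
  have i3 := i1.add i2
  have eqv : ∀ t ∈ Icc (0 : ℝ) 1, β (a t, v t) + β (u t, b t) = β (a t, W t) + β (U t, b t) :=
    fun t ht => by rw [hu t ht, hv t ht]
  refine ⟨i3.congr fun t ht => ?_, fun x hx => ?_⟩
  · rw [uIoc_of_le zero_le_one] at ht
    exact (eqv t (Ioc_subset_Icc_self ht)).symm
  have eqi : ∫ t in (0 : ℝ)..x, (β (a t, v t) + β (u t, b t)) =
      ∫ t in (0 : ℝ)..x, (β (a t, W t) + β (U t, b t)) := by
    refine intervalIntegral.integral_congr fun t ht => eqv t ?_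
    rw [uIcc_of_le hx.1] at ht
    exact ⟨ht.1, ht.2.trans hx.2⟩
  rw [eqi]
  -- The difference of the two sides is absolutely continuous with derivative zero almost
  -- everywhere, hence constant.
  set g : ℝ → G := fun x => β (U x, W x) -
    ∫ t in (0 : ℝ)..x, (β (a t, W t) + β (U t, b t)) with hg
  have gac : AbsolutelyContinuousOnInterval g 0 1 :=
    (absolutelyContinuousOnInterval_bilinear hβ hUac hWac).sub
      (absolutelyContinuousOnInterval_primitive i3)
  have gder : ∀ᵐ x, x ∈ uIcc (0 : ℝ) 1 → HasDerivAt g 0 x := by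
    filter_upwards [ha.ae_hasDerivAt_integral, hb.ae_hasDerivAt_integral,
      i3.ae_hasDerivAt_integral] with x h1 h2 h3 hx
    have k1 : HasDerivAt U (a x) x := (h1 hx 0 (by simp)).const_add _
    have k2 : HasDerivAt W (b x) x := (h2 hx 0 (by simp)).const_add _
    have k3 := h3 hx 0 (by simp)
    have k4 := (hβ.hasFDerivAt (U x, W x)).comp_hasDerivAt x (k1.prodMk k2)
    have k5 := k4.sub k3
    convert! k5 using 1
    simp [add_comm]
  obtain ⟨C, hC⟩ := gac.const_of_ae_hasDerivAt_zero gder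
  have c0 := hC 0 (by simp)
  have cx := hC x (by rwa [uIcc_of_le zero_le_one])
  rw [← c0] at cx
  simp only [hg, hU, hW, intervalIntegral.integral_same, add_zero, sub_zero] at cx
  rw [hu x hx, hv x hx]
  exact sub_eq_iff_eq_add.mp cx

/-- A bound for continuous functions that satisfy a Volterra inequality with a small kernel. -/
theorem le_two_mul_of_volterra {u g : ℝ → ℝ} {a b : ℝ} (hu : ContinuousOn u (Icc 0 1))
    (hu0 : ∀ x ∈ Icc (0 : ℝ) 1, 0 ≤ u x)
    (hg : IntervalIntegrable g volume 0 1) (hg0 : ∀ t, 0 ≤ g t) (hb : 0 ≤ b)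
    (hab : ∀ x ∈ Icc (0 : ℝ) 1, u x ≤ a + b * ∫ t in (0 : ℝ)..x, g t * u t)
    (hsmall : b * (∫ t in (0 : ℝ)..1, g t) ≤ 1 / 2) :
    ∀ x ∈ Icc (0 : ℝ) 1, u x ≤ 2 * a := by
  -- At a maximum point y the inequality reads u(y) ≤ a + u(y)/2, so no Gronwall iteration is
  -- needed.
  obtain ⟨y, hy, hmax⟩ := isCompact_Icc.exists_isMaxOn (nonempty_Icc.2 zero_le_one) hu
  have hmax' : ∀ x ∈ Icc (0 : ℝ) 1, u x ≤ u y := fun x hx => hmax hx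
  have h1 : ∫ t in (0 : ℝ)..y, g t * u t ≤ ∫ t in (0 : ℝ)..y, g t * u y := by
    have hgy := intervalIntegrable_of_mem hg (by simp) hy (x := 0)
    refine intervalIntegral.integral_mono_on hy.1 (hgy.mul_continuousOn (hu.mono ?_))
      (hgy.mul_const _) fun t ht => ?_
    · rw [uIcc_of_le hy.1]; exact Icc_subset_Icc_right hy.2
    · exact mul_le_mul_of_nonneg_left (hmax' t ⟨ht.1, ht.2.trans hy.2⟩) (hg0 t)
  have h2 : ∫ t in (0 : ℝ)..y, g t ≤ ∫ t in (0 : ℝ)..1, g t :=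
    intervalIntegral.integral_mono_interval le_rfl hy.1 hy.2
      (Eventually.of_forall hg0) hg
  rw [intervalIntegral.integral_mul_const] at h1
  have hy0 := hu0 y hy
  have h3 : u y ≤ a + 1 / 2 * u y := by
    calc u y ≤ a + b * ∫ t in (0 : ℝ)..y, g t * u t := hab y hy
      _ ≤ a + b * ((∫ t in (0 : ℝ)..1, g t) * u y) := by gcongr; exact h1.trans (by gcongr)
      _ = a + b * (∫ t in (0 : ℝ)..1, g t) * u y := by ring
      _ ≤ _ := by gcongr
  intro x hx
  linarith [hmax' x hx]

end Primitives

/-! ### Solutions of the Schrödinger equation -/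

section Solutions

variable {N : ℕ}

/-- A matrix as a continuous linear operator on the Euclidean space. -/
abbrev op (A : Matrix (Fin N) (Fin N) ℂ) :
    EuclideanSpace ℂ (Fin N) →L[ℂ] EuclideanSpace ℂ (Fin N) :=
  Matrix.toEuclideanCLM (n := Fin N) (𝕜 := ℂ) A

theorem toEuclideanLin_eq_op (A : Matrix (Fin N) (Fin N) ℂ) (x : EuclideanSpace ℂ (Fin N)) :
    Matrix.toEuclideanLin A x = op A x := rfl

theorem op_eq_sum (A : Matrix (Fin N) (Fin N) ℂ) :
    op A = ∑ i, ∑ j, A i j • op (Matrix.single i j 1) := by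
  conv_lhs => rw [Matrix.matrix_eq_sum_single A]
  simp only [op, map_sum]
  refine Finset.sum_congr rfl fun i _ => Finset.sum_congr rfl fun j _ => ?_
  rw [← map_smul, Matrix.smul_single, smul_eq_mul, mul_one]

theorem integrable_sum_smul {X : Type*} [NormedAddCommGroup X] [NormedSpace ℂ X] {μ : Measure ℝ}
    {V : ℝ → Matrix (Fin N) (Fin N) ℂ} (hV : ∀ i j, Integrable (fun t => V t i j) μ)
    (c : Fin N → Fin N → X) : Integrable (fun t => ∑ i, ∑ j, V t i j • c i j) μ :=
  integrable_finsetSum _ fun i _ => integrable_finsetSum _ fun j _ => (hV i j).smul_const _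

theorem IsPotential.intervalIntegrable {V : ℝ → Matrix (Fin N) (Fin N) ℂ} (hV : IsPotential V) :
    IntervalIntegrable (fun t => op (V t)) volume 0 1 := by
  rw [intervalIntegrable_iff_integrableOn_Ioo_of_le zero_le_one]
  exact (integrable_sum_smul hV.1 _).congr (Eventually.of_forall fun t => (op_eq_sum (V t)).symm)

/-- The `L¹` norm of a matrix potential. -/
def potentialNorm (V : ℝ → Matrix (Fin N) (Fin N) ℂ) : ℝ := ∫ t in (0 : ℝ)..1, ‖op (V t)‖

theorem potentialNorm_nonneg (V : ℝ → Matrix (Fin N) (Fin N) ℂ) : 0 ≤ potentialNorm V :=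
  intervalIntegral.integral_nonneg zero_le_one fun _ _ => norm_nonneg _

variable {V : ℝ → Matrix (Fin N) (Fin N) ℂ} {lam : ℂ} {ψ p : ℝ → EuclideanSpace ℂ (Fin N)}

theorem IsSolution.continuousOn (h : IsSolution V lam ψ p) : ContinuousOn ψ (Icc 0 1) := by
  have hp : IntervalIntegrable p volume 0 1 :=
    ContinuousOn.intervalIntegrable (by rw [uIcc_of_le zero_le_one]; exact h.1)
  exact (continuousOn_const.add (continuousOn_primitive_unit hp)).congr h.3

theorem IsSolution.intervalIntegrable_deriv (h : IsSolution V lam ψ p) :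
    IntervalIntegrable p volume 0 1 :=
  ContinuousOn.intervalIntegrable (by rw [uIcc_of_le zero_le_one]; exact h.1)

theorem eq_primitive_of_hasDerivAt {u a : ℝ → ℂ} (h : ∀ x, HasDerivAt u (a x) x)
    (ha : Continuous a) (x : ℝ) : u x = u 0 + ∫ t in (0 : ℝ)..x, a t := by
  rw [intervalIntegral.integral_eq_sub_of_hasDerivAt (fun t _ => h t)
    (ha.intervalIntegrable _ _)]
  ring

/-- Variation of parameters: a solution of `ψ'' = V ψ - lam ψ` is represented by the
fundamental system `c`, `s` of the scalar equation `s'' = -κ s`. -/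
theorem IsSolution.variation_of_parameters (h : IsSolution V lam ψ p) {s c : ℝ → ℂ} {κ : ℂ}
    (hs : ∀ x, HasDerivAt s (c x) x) (hc : ∀ x, HasDerivAt c (-κ * s x) x)
    (hs0 : s 0 = 0) (hc0 : c 0 = 1) {x : ℝ} (hx : x ∈ Icc (0 : ℝ) 1) :
    ψ x = c x • ψ 0 + s x • p 0 +
      ∫ t in (0 : ℝ)..x, s (x - t) • (rhs V lam ψ t + κ • ψ t) := by
  have hsc : Continuous s := continuous_iff_continuousAt.2 fun x => (hs x).continuousAt
  have hcc : Continuous c := continuous_iff_continuousAt.2 fun x => (hc x).continuousAt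
  have hβ : IsBoundedBilinearMap ℝ fun q : ℂ × EuclideanSpace ℂ (Fin N) => q.1 • q.2 :=
    isBoundedBilinearMap_smul
  have hsub : ∀ t, HasDerivAt (fun t : ℝ => x - t) (-1) t := fun t => by
    simpa using (hasDerivAt_id t).const_sub x
  have d1 : ∀ t, HasDerivAt (fun t => c (x - t)) (κ * s (x - t)) t := fun t => by
    have := (hc (x - t)).scomp t (hsub t)
    convert! this using 1
    simp
  have d2 : ∀ t, HasDerivAt (fun t => s (x - t)) (-c (x - t)) t := fun t => by
    have := (hs (x - t)).scomp t (hsub t)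
    convert! this using 1
    simp
  have c1 : Continuous fun t => κ * s (x - t) := by fun_prop
  have c2 : Continuous fun t => -c (x - t) := by fun_prop
  obtain ⟨i1, e1⟩ := bilinear_primitive hβ (c1.intervalIntegrable _ _)
    h.intervalIntegrable_deriv (fun t _ => eq_primitive_of_hasDerivAt d1 c1 t) h.3
  obtain ⟨i2, e2⟩ := bilinear_primitive hβ (c2.intervalIntegrable _ _)
    h.2 (fun t _ => eq_primitive_of_hasDerivAt d2 c2 t) h.4
  have e := congrArg₂ (· + ·) (e1 x hx) (e2 x hx)
  simp only [sub_self, sub_zero, hc0, hs0, one_smul, zero_smul, add_zero] at e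
  rw [e]
  have h0 : (0 : ℝ) ∈ Icc (0 : ℝ) 1 := by simp
  rw [add_add_add_comm, ← intervalIntegral.integral_add (intervalIntegrable_of_mem i1 h0 hx)
    (intervalIntegrable_of_mem i2 h0 hx)]
  congr 1
  refine intervalIntegral.integral_congr fun t _ => ?_
  simp only [smul_add, neg_smul, smul_smul]
  rw [mul_comm κ]
  abel

/-- A priori estimates for a solution vanishing at `0`. -/
theorem IsSolution.norm_le_of_kernel (h : IsSolution V lam ψ p) (hψ : ψ 0 = 0) {s c : ℝ → ℂ}
    {κ : ℂ} (hs : ∀ x, HasDerivAt s (c x) x) (hc : ∀ x, HasDerivAt c (-κ * s x) x)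
    (hs0 : s 0 = 0) (hc0 : c 0 = 1) {τ r : ℝ} (hr : 0 < r)
    (hsb : ∀ y ∈ Icc (0 : ℝ) 1, ‖s y‖ ≤ Real.exp (τ * y) / r) {g : ℝ → ℝ}
    (hg : IntervalIntegrable g volume 0 1) (hg0 : ∀ t, 0 ≤ g t)
    (hw : ∀ t, ‖rhs V lam ψ t + κ • ψ t‖ ≤ g t * ‖ψ t‖)
    (hsmall : (∫ t in (0 : ℝ)..1, g t) ≤ r / 2) {x : ℝ} (hx : x ∈ Icc (0 : ℝ) 1) :
    ‖ψ x‖ ≤ 2 * ‖p 0‖ / r * Real.exp (τ * x) ∧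
    ‖ψ x - s x • p 0‖ ≤ 2 * ‖p 0‖ / r ^ 2 * (∫ t in (0 : ℝ)..1, g t) * Real.exp (τ * x) := by
  have hsc : Continuous s := continuous_iff_continuousAt.2 fun x => (hs x).continuousAt
  have h0 : (0 : ℝ) ∈ Icc (0 : ℝ) 1 := by simp
  -- The weight turns the kernel bound e^{τ(x−t)}/r into the constant 1/r.
  set u : ℝ → ℝ := fun x => Real.exp (-(τ * x)) * ‖ψ x‖ with hu
  have huc : ContinuousOn u (Icc 0 1) :=
    (Continuous.continuousOn (by fun_prop)).mul h.continuousOn.norm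
  have hu0 : ∀ x ∈ Icc (0 : ℝ) 1, 0 ≤ u x := fun x _ => by positivity
  have hgu : IntervalIntegrable (fun t => g t * u t) volume 0 1 :=
    hg.mul_continuousOn (by rwa [uIcc_of_le zero_le_one])
  have hint : ∀ x ∈ Icc (0 : ℝ) 1,
      ‖ψ x - s x • p 0‖ ≤ Real.exp (τ * x) * (1 / r * ∫ t in (0 : ℝ)..x, g t * u t) := by
    intro x hx
    have e := h.variation_of_parameters hs hc hs0 hc0 hx
    rw [hψ, smul_zero, zero_add] at e
    rw [e, add_sub_cancel_left, ← mul_assoc, ← intervalIntegral.integral_const_mul]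
    refine intervalIntegral.norm_integral_le_of_norm_le hx.1 ?_
      ((intervalIntegrable_of_mem hgu h0 hx).const_mul _)
    refine Eventually.of_forall fun t ht => ?_
    rw [norm_smul]
    calc ‖s (x - t)‖ * ‖rhs V lam ψ t + κ • ψ t‖
        ≤ (Real.exp (τ * (x - t)) / r) * (g t * ‖ψ t‖) :=
          mul_le_mul (hsb _ ⟨by linarith [ht.2], by linarith [ht.1, hx.2]⟩) (hw t)
            (norm_nonneg _) (by positivity)
      _ = Real.exp (τ * x) * (1 / r) * (g t * u t) := by
          have : Real.exp (τ * (x - t)) = Real.exp (τ * x) * Real.exp (-(τ * t)) := by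
            rw [← Real.exp_add]; ring_nf
          rw [this, hu]; ring
  have hub : ∀ x ∈ Icc (0 : ℝ) 1, u x ≤ 2 * (‖p 0‖ / r) := by
    refine le_two_mul_of_volterra huc hu0 hg hg0 (b := 1 / r) (by positivity) (fun x hx => ?_) ?_
    · have k1 : ‖ψ x‖ ≤ ‖s x • p 0‖ + ‖ψ x - s x • p 0‖ := by
        have := norm_add_le (s x • p 0) (ψ x - s x • p 0)
        rwa [add_sub_cancel] at this
      have k2 : ‖s x • p 0‖ ≤ Real.exp (τ * x) / r * ‖p 0‖ := by
        rw [norm_smul]; gcongr; exact hsb x hx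
      have k3 := k1.trans (add_le_add k2 (hint x hx))
      calc u x ≤ Real.exp (-(τ * x)) * (Real.exp (τ * x) / r * ‖p 0‖ +
            Real.exp (τ * x) * (1 / r * ∫ t in (0 : ℝ)..x, g t * u t)) := by
            simp only [hu]; gcongr
        _ = (Real.exp (-(τ * x)) * Real.exp (τ * x)) *
            (‖p 0‖ / r + 1 / r * ∫ t in (0 : ℝ)..x, g t * u t) := by ring
        _ = _ := by rw [← Real.exp_add]; simp
    · rw [one_div, inv_mul_le_iff₀ hr]; linarith
  constructor
  · have := hub x hx
    calc ‖ψ x‖ = u x * Real.exp (τ * x) := by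
          simp only [hu]; rw [mul_right_comm, ← Real.exp_add]; simp
      _ ≤ 2 * (‖p 0‖ / r) * Real.exp (τ * x) := by gcongr
      _ = _ := by ring
  · have k1 : ∫ t in (0 : ℝ)..x, g t * u t ≤ (∫ t in (0 : ℝ)..1, g t) * (2 * (‖p 0‖ / r)) := by
      rw [← intervalIntegral.integral_mul_const]
      refine (intervalIntegral.integral_mono_on hx.1 (intervalIntegrable_of_mem hgu h0 hx)
        ((intervalIntegrable_of_mem hg h0 hx).mul_const _) fun t ht =>
          mul_le_mul_of_nonneg_left (hub t ⟨ht.1, ht.2.trans hx.2⟩) (hg0 t)).trans ?_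
      exact intervalIntegral.integral_mono_interval le_rfl hx.1 hx.2
        (Eventually.of_forall fun t => mul_nonneg (hg0 t) (by positivity)) (hg.mul_const _)
    calc ‖ψ x - s x • p 0‖ ≤ Real.exp (τ * x) * (1 / r * ∫ t in (0 : ℝ)..x, g t * u t) :=
          hint x hx
      _ ≤ Real.exp (τ * x) * (1 / r * ((∫ t in (0 : ℝ)..1, g t) * (2 * (‖p 0‖ / r)))) := by
          gcongr
      _ = _ := by field_simp

/-- Solutions with zero initial data vanish. -/
theorem IsSolution.eq_zero (hV : IsPotential V) (h : IsSolution V lam ψ p) (hψ : ψ 0 = 0)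
    (hp : p 0 = 0) {x : ℝ} (hx : x ∈ Icc (0 : ℝ) 1) : ψ x = 0 := by
  set g : ℝ → ℝ := fun t => ‖op (V t)‖ + ‖lam‖ with hg
  have hgi : IntervalIntegrable g volume 0 1 :=
    hV.intervalIntegrable.norm.add intervalIntegrable_const
  have hg0 : ∀ t, 0 ≤ g t := fun t => by positivity
  -- With κ = 0 the kernel is s(x) = x, and x ≤ e^{rx}/r for every r > 0. So r = τ may be taken
  -- large enough for ∫ g ≤ r/2, and the term in `lam` is absorbed into g.
  set r : ℝ := 2 * (∫ t in (0 : ℝ)..1, g t) + 1 with hr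
  have hr0 : 0 < r := by
    have := intervalIntegral.integral_nonneg zero_le_one (fun t _ => hg0 t) (μ := volume)
      (a := 0) (b := 1)
    positivity
  have key := (h.norm_le_of_kernel hψ (s := fun x => (x : ℂ)) (c := fun _ => 1) (κ := 0)
    (fun x => Complex.ofRealCLM.hasDerivAt) (fun x => by simpa using hasDerivAt_const x (1 : ℂ))
    (by simp) rfl hr0 (τ := r) (fun y hy => ?_) hgi hg0 (fun t => ?_) (by linarith) hx).1
  · rw [hp] at key
    simpa using key
  · rw [Complex.norm_real, Real.norm_of_nonneg hy.1, le_div_iff₀ hr0]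
    linarith [Real.add_one_le_exp (r * y)]
  · rw [zero_smul, add_zero, rhs, toEuclideanLin_eq_op, hg, add_mul]
    refine (norm_sub_le _ _).trans (add_le_add ((op (V t)).le_opNorm _) (norm_smul_le _ _))

theorem hasDerivAt_sin_mul_div {z : ℂ} (hz : z ≠ 0) (x : ℝ) :
    HasDerivAt (fun x : ℝ => Complex.sin (z * x) / z) (Complex.cos (z * x)) x := by
  have h1 : HasDerivAt (fun w : ℂ => z * w) z (x : ℂ) := by
    simpa using (hasDerivAt_id (x : ℂ)).const_mul z
  have := ((h1.csin).div_const z).comp_ofReal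
  rwa [mul_div_cancel_right₀ _ hz] at this

theorem hasDerivAt_cos_mul {z : ℂ} (hz : z ≠ 0) (x : ℝ) :
    HasDerivAt (fun x : ℝ => Complex.cos (z * x)) (-z ^ 2 * (Complex.sin (z * x) / z)) x := by
  have h1 : HasDerivAt (fun w : ℂ => z * w) z (x : ℂ) := by
    simpa using (hasDerivAt_id (x : ℂ)).const_mul z
  have := h1.ccos.comp_ofReal
  convert! this using 1
  field_simp

theorem norm_sin_le_exp (w : ℂ) : ‖Complex.sin w‖ ≤ Real.exp |w.im| := by
  rw [Complex.sin, norm_div, norm_mul, Complex.norm_I, mul_one, Complex.norm_ofNat,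
    div_le_iff₀ two_pos]
  refine (norm_sub_le _ _).trans ?_
  rw [Complex.norm_exp, Complex.norm_exp]
  have h1 : (-w * Complex.I).re ≤ |w.im| := by simpa using le_abs_self _
  have h2 : (w * Complex.I).re ≤ |w.im| := by simpa using neg_le_abs _
  linarith [Real.exp_le_exp.2 h1, Real.exp_le_exp.2 h2]

/-- Asymptotics of a solution vanishing at `0` for large values of the spectral parameter. -/
theorem IsSolution.asymptotics (hV : IsPotential V) {z : ℂ} (hz : z ≠ 0)
    (h : IsSolution V (z ^ 2) ψ p) (hψ : ψ 0 = 0) (hzV : 2 * potentialNorm V ≤ ‖z‖) :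
    ‖ψ 1‖ ≤ 2 * ‖p 0‖ / ‖z‖ * Real.exp |z.im| ∧
    ‖ψ 1 - (Complex.sin z / z) • p 0‖ ≤
      2 * ‖p 0‖ / ‖z‖ ^ 2 * potentialNorm V * Real.exp |z.im| := by
  have key := h.norm_le_of_kernel hψ (s := fun x : ℝ => Complex.sin (z * x) / z)
    (c := fun x : ℝ => Complex.cos (z * x)) (κ := z ^ 2) (hasDerivAt_sin_mul_div hz)
    (hasDerivAt_cos_mul hz) (by simp) (by simp) (norm_pos_iff.2 hz) (τ := |z.im|)
    (fun y hy => ?_) hV.intervalIntegrable.norm (fun t => norm_nonneg _) (fun t => ?_)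
    (by rw [potentialNorm] at hzV; linarith) (x := 1) (by simp)
  · simpa [potentialNorm] using key
  · rw [norm_div]
    gcongr
    refine (norm_sin_le_exp _).trans (Real.exp_le_exp.2 (le_of_eq ?_))
    simp [abs_mul, abs_of_nonneg hy.1]
  · rw [rhs, toEuclideanLin_eq_op, sub_add_cancel]
    exact (op (V t)).le_opNorm _

/-- The Lagrange identity. -/
theorem IsSolution.lagrange (hV : IsPotential V) {mu : ℂ} {χ q : ℝ → EuclideanSpace ℂ (Fin N)}
    (h₁ : IsSolution V mu ψ p) (h₂ : IsSolution V lam χ q) (hψ : ψ 0 = 0) (hχ : χ 0 = 0) :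
    inner ℂ (ψ 1) (q 1) - inner ℂ (p 1) (χ 1) =
      (star mu - lam) * ∫ t in (0 : ℝ)..1, inner ℂ (ψ t) (χ t) := by
  have hβ : IsBoundedBilinearMap ℝ fun q : EuclideanSpace ℂ (Fin N) × EuclideanSpace ℂ (Fin N) =>
    inner ℂ q.1 q.2 := isBoundedBilinearMap_inner
  obtain ⟨i1, e1⟩ := bilinear_primitive hβ h₁.intervalIntegrable_deriv h₂.2 h₁.3 h₂.4
  obtain ⟨i2, e2⟩ := bilinear_primitive hβ h₁.2 h₂.intervalIntegrable_deriv h₁.4 h₂.3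
  have h1 : (1 : ℝ) ∈ Icc (0 : ℝ) 1 := by simp
  have e := congrArg₂ (· - ·) (e1 1 h1) (e2 1 h1)
  simp only [hψ, hχ, inner_zero_left, inner_zero_right, zero_add] at e
  rw [e, ← intervalIntegral.integral_sub i1 i2, ← intervalIntegral.integral_const_mul]
  refine intervalIntegral.integral_congr_ae_restrict ?_
  rw [uIoc_of_le zero_le_one, ← restrict_Ioo_eq_restrict_Ioc]
  filter_upwards [hV.2] with t ht
  have hsym : inner ℂ (op (V t) (ψ t)) (χ t) = inner ℂ (ψ t) (op (V t) (χ t)) := by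
    rw [← ContinuousLinearMap.adjoint_inner_right]
    have : ContinuousLinearMap.adjoint (op (V t)) = op (V t) := by
      rw [← ContinuousLinearMap.star_eq_adjoint, ← map_star, Matrix.star_eq_conjTranspose, ht.eq]
    rw [this]
  simp only [rhs, toEuclideanLin_eq_op, inner_sub_left, inner_sub_right, inner_smul_left,
    inner_smul_right, hsym]
  simp only [starRingEnd_apply]
  ring

end Solutions

/-! ### Existence of solutions and dependence on the spectral parameter -/

section Volterra

open scoped BoundedContinuousFunction

/-- The kernel `max(s, 0) e^{-ρ s}`. -/
def weightKernel (ρ s : ℝ) : ℝ := max s 0 * Real.exp (-(ρ * s))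

theorem weightKernel_nonneg (ρ s : ℝ) : 0 ≤ weightKernel ρ s := by
  unfold weightKernel; positivity

theorem continuous_weightKernel (ρ : ℝ) : Continuous (weightKernel ρ) := by
  unfold weightKernel; fun_prop

/-- Follows from ρs ≤ e^{ρs}. The factor 1/ρ makes the Volterra operator a contraction for large ρ,
so one Neumann inversion covers all of [0,1]. -/
theorem weightKernel_le {ρ : ℝ} (hρ : 0 < ρ) (s : ℝ) : weightKernel ρ s ≤ 1 / ρ := by
  unfold weightKernel
  rcases le_total s 0 with hs | hs
  · rw [max_eq_right hs, zero_mul]; positivity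
  · rw [max_eq_left hs, Real.exp_neg, ← div_eq_mul_inv, div_le_div_iff₀ (Real.exp_pos _) hρ]
    linarith [Real.add_one_le_exp (ρ * s)]

variable {H : Type*} [NormedAddCommGroup H] [NormedSpace ℂ H]

theorem integrable_clm_apply_bcf {μ : Measure ℝ} {w : ℝ → H →L[ℂ] H} (hw : Integrable w μ)
    (f : ℝ →ᵇ H) : Integrable (fun t => w t (f t)) μ := by
  refine (hw.norm.mul_const ‖f‖).mono' ?_ ?_
  · exact (isBoundedBilinearMap_apply (𝕜 := ℂ)).continuous.comp_aestronglyMeasurable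
      (hw.1.prodMk f.continuous.aestronglyMeasurable)
  · exact Eventually.of_forall fun t =>
      ((w t).le_opNorm _).trans (by gcongr; exact f.norm_coe_le_norm t)

theorem integrable_kernel_smul {ρ : ℝ} (hρ : 0 < ρ) {μ : Measure ℝ} {g : ℝ → H}
    (hg : Integrable g μ) (x : ℝ) : Integrable (fun t => weightKernel ρ (x - t) • g t) μ := by
  have hc : Continuous fun t => weightKernel ρ (x - t) :=
    (continuous_weightKernel ρ).comp (continuous_const.sub continuous_id)
  refine (hg.norm.const_mul (1 / ρ)).mono' (hc.aestronglyMeasurable.smul hg.1)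
    (Eventually.of_forall fun t => ?_)
  rw [norm_smul, Real.norm_of_nonneg (weightKernel_nonneg _ _)]
  gcongr
  exact weightKernel_le hρ _

theorem norm_integral_kernel_le {ρ : ℝ} (hρ : 0 < ρ) {μ : Measure ℝ} {w : ℝ → H →L[ℂ] H}
    (hw : Integrable w μ) (f : ℝ →ᵇ H) (x : ℝ) :
    ‖∫ t, weightKernel ρ (x - t) • w t (f t) ∂μ‖ ≤ (∫ t, ‖w t‖ ∂μ) / ρ * ‖f‖ := by
  have : (∫ t, ‖w t‖ ∂μ) / ρ * ‖f‖ = ∫ t, 1 / ρ * (‖w t‖ * ‖f‖) ∂μ := by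
    rw [integral_const_mul, integral_mul_const]; ring
  rw [this]
  refine norm_integral_le_of_norm_le ((hw.norm.mul_const _).const_mul _)
    (Eventually.of_forall fun t => ?_)
  rw [norm_smul, Real.norm_of_nonneg (weightKernel_nonneg _ _)]
  exact mul_le_mul (weightKernel_le hρ _)
    (((w t).le_opNorm _).trans (by gcongr; exact f.norm_coe_le_norm t)) (norm_nonneg _)
    (by positivity)

/-- The Volterra operator with kernel `weightKernel ρ (x - t) w(t)`. -/
def volterra {ρ : ℝ} (hρ : 0 < ρ) {μ : Measure ℝ} {w : ℝ → H →L[ℂ] H} (hw : Integrable w μ) :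
    (ℝ →ᵇ H) →L[ℂ] (ℝ →ᵇ H) :=
  LinearMap.mkContinuous
    { toFun := fun f => BoundedContinuousFunction.ofNormedAddCommGroup
        (fun x => ∫ t, weightKernel ρ (x - t) • w t (f t) ∂μ)
        (by
          refine continuous_of_dominated (bound := fun t => 1 / ρ * ‖w t (f t)‖)
            (fun x => (integrable_kernel_smul hρ (integrable_clm_apply_bcf hw f) x).1)
            (fun x => Eventually.of_forall fun t => ?_)
            ((integrable_clm_apply_bcf hw f).norm.const_mul _)
            (Eventually.of_forall fun t => ?_)
          · rw [norm_smul, Real.norm_of_nonneg (weightKernel_nonneg _ _)]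
            gcongr
            exact weightKernel_le hρ _
          · exact ((continuous_weightKernel ρ).comp (by fun_prop)).smul continuous_const)
        ((∫ t, ‖w t‖ ∂μ) / ρ * ‖f‖) (norm_integral_kernel_le hρ hw f)
      map_add' := fun f g => by
        ext x
        simp only [BoundedContinuousFunction.coe_ofNormedAddCommGroup,
          BoundedContinuousFunction.coe_add, Pi.add_apply, map_add, smul_add]
        exact integral_add (integrable_kernel_smul hρ (integrable_clm_apply_bcf hw f) x)
          (integrable_kernel_smul hρ (integrable_clm_apply_bcf hw g) x)
      map_smul' := fun c f => by
        ext x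
        simp only [BoundedContinuousFunction.coe_ofNormedAddCommGroup,
          BoundedContinuousFunction.coe_smul, map_smul, RingHom.id_apply]
        rw [← integral_smul]
        refine integral_congr_ae (Eventually.of_forall fun t => ?_)
        exact smul_comm _ _ _ }
    ((∫ t, ‖w t‖ ∂μ) / ρ)
    (fun f => (BoundedContinuousFunction.norm_le (by positivity)).2
      (norm_integral_kernel_le hρ hw f))

theorem norm_volterra_le {ρ : ℝ} (hρ : 0 < ρ) {μ : Measure ℝ} {w : ℝ → H →L[ℂ] H}
    (hw : Integrable w μ) : ‖volterra hρ hw‖ ≤ (∫ t, ‖w t‖ ∂μ) / ρ :=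
  LinearMap.mkContinuous_norm_le _ (by positivity) _

/-- The bounded continuous function `weightKernel ρ · h`. -/
def kernelVec {ρ : ℝ} (hρ : 0 < ρ) (h : H) : ℝ →ᵇ H :=
  BoundedContinuousFunction.ofNormedAddCommGroup (fun x => weightKernel ρ x • h)
    ((continuous_weightKernel ρ).smul continuous_const) (1 / ρ * ‖h‖) (fun x => by
      rw [norm_smul, Real.norm_of_nonneg (weightKernel_nonneg _ _)]
      gcongr
      exact weightKernel_le hρ _)

/-- Solvability of the weighted Volterra equation and analytic dependence on the spectral
parameter. -/
theorem exists_volterra_solution [CompleteSpace H] {w : ℝ → H →L[ℂ] H}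
    (hw : IntervalIntegrable w volume 0 1) (h : H) (lam₀ : ℂ) :
    ∃ (ρ : ℝ) (f : ℂ → ℝ →ᵇ H), DifferentiableAt ℂ f lam₀ ∧
      ∀ᶠ lam in 𝓝 lam₀, ∀ x ∈ Icc (0 : ℝ) 1, f lam x = weightKernel ρ x • h +
        ∫ t in (0 : ℝ)..1, weightKernel ρ (x - t) • (w t (f lam t) - lam • f lam t) := by
  rw [intervalIntegrable_iff_integrableOn_Ioc_of_le zero_le_one] at hw
  set μ := volume.restrict (Ioc (0 : ℝ) 1) with hμ
  have h1 : Integrable (fun _ : ℝ => (1 : H →L[ℂ] H)) μ := integrable_const _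
  set a := ∫ t, ‖w t‖ ∂μ with ha
  have ha0 : 0 ≤ a := by positivity
  set R : ℝ := ‖lam₀‖ + 1
  -- This exceeds a + R, so K − λJ has norm below 1 for all ‖λ‖ ≤ R, and analyticity in λ is
  -- inherited from inversion.
  set ρ : ℝ := a + R + 1
  have hρ : 0 < ρ := by positivity
  set K := volterra hρ hw
  set J := volterra hρ h1
  have hJ : ‖J‖ ≤ 1 / ρ := by
    refine (norm_volterra_le hρ h1).trans ?_
    gcongr
    rw [integral_const]
    have : ‖(1 : H →L[ℂ] H)‖ ≤ 1 := ContinuousLinearMap.norm_id_le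
    simpa [hμ] using this
  have hunit : ∀ lam : ℂ, ‖lam‖ ≤ R → IsUnit (1 - (K - lam • J)) := by
    intro lam hlam
    refine isUnit_one_sub_of_norm_lt_one ?_
    calc ‖K - lam • J‖ ≤ ‖K‖ + ‖lam‖ * ‖J‖ := (norm_sub_le _ _).trans (by rw [norm_smul])
      _ ≤ a / ρ + R * (1 / ρ) := by gcongr; exact norm_volterra_le hρ hw
      _ = (a + R) / ρ := by ring
      _ < 1 := by rw [div_lt_one hρ]; linarith
  refine ⟨ρ, fun lam => Ring.inverse (1 - (K - lam • J)) (kernelVec hρ h), ?_, ?_⟩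
  · have d1 : DifferentiableAt ℂ (fun lam : ℂ => 1 - (K - lam • J)) lam₀ := by fun_prop
    have d2 := (differentiableAt_inverse (𝕜 := ℂ) (hunit lam₀ (by simp [R]))).comp lam₀ d1
    exact d2.clm_apply (differentiableAt_const _)
  · have hnear : ∀ᶠ lam in 𝓝 lam₀, ‖lam‖ < R :=
      continuous_norm.continuousAt.eventually_lt continuousAt_const (by simp [R])
    filter_upwards [hnear] with lam hlam x hx
    set f := Ring.inverse (1 - (K - lam • J)) (kernelVec hρ h) with hf
    have e : (1 - (K - lam • J)) f = kernelVec hρ h := by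
      rw [hf, ← mul_apply_eq_comp, Ring.mul_inverse_cancel _ (hunit lam hlam.le)]
      rfl
    have e2 : f = kernelVec hρ h + (K f - lam • J f) := by
      rw [← e]; simp
    have e3 := congrArg (fun g : ℝ →ᵇ H => g x) e2
    simp only [BoundedContinuousFunction.coe_add, BoundedContinuousFunction.coe_sub,
      BoundedContinuousFunction.coe_smul, Pi.add_apply, Pi.sub_apply] at e3
    have eK : K f x = ∫ t, weightKernel ρ (x - t) • w t (f t) ∂μ := rfl
    have eJ : J f x = ∫ t, weightKernel ρ (x - t) • (1 : H →L[ℂ] H) (f t) ∂μ := rfl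
    have i1 : Integrable (fun t => weightKernel ρ (x - t) • w t (f t)) μ :=
      integrable_kernel_smul hρ (integrable_clm_apply_bcf hw f) x
    have i2 : Integrable (fun t => lam • weightKernel ρ (x - t) • (1 : H →L[ℂ] H) (f t)) μ :=
      (integrable_kernel_smul hρ (integrable_clm_apply_bcf h1 f) x).smul lam
    rw [e3, eK, eJ, ← integral_smul, ← integral_sub i1 i2,
      intervalIntegral.integral_of_le zero_le_one]
    congr 1
    refine integral_congr_ae (Eventually.of_forall fun t => ?_)
    simp only [one_apply_eq_self, smul_sub]
    rw [smul_comm]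

/-- Cauchy's formula for the repeated integral. -/
theorem integral_primitive_eq {g : ℝ → H} [CompleteSpace H]
    (hg : IntervalIntegrable g volume 0 1) (h : H) {x : ℝ} (hx : x ∈ Icc (0 : ℝ) 1) :
    ∫ t in (0 : ℝ)..x, (h + ∫ s in (0 : ℝ)..t, g s) =
      x • h + ∫ t in (0 : ℝ)..x, (x - t) • g t := by
  have hβ : IsBoundedBilinearMap ℝ fun q : ℝ × H => q.1 • q.2 := isBoundedBilinearMap_smul
  obtain ⟨i, e⟩ := bilinear_primitive hβ (u := fun t => x - t) (a := fun _ => -1)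
    (v := fun t => h + ∫ s in (0 : ℝ)..t, g s) (b := g) intervalIntegrable_const hg
    (fun t _ => by simp; ring) (fun t _ => by simp)
  have h0 : (0 : ℝ) ∈ Icc (0 : ℝ) 1 := by simp
  have e := e x hx
  have hc : IntervalIntegrable (fun t => h + ∫ s in (0 : ℝ)..t, g s) volume 0 1 :=
    ContinuousOn.intervalIntegrable (by
      rw [uIcc_of_le zero_le_one]
      exact continuousOn_const.add (continuousOn_primitive_unit hg))
  have hc2 : IntervalIntegrable (fun t => (x - t) • g t) volume 0 1 :=
    hg.continuousOn_smul (Continuous.continuousOn (by fun_prop))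
  have hneg : IntervalIntegrable (fun t => -(h + ∫ s in (0 : ℝ)..t, g s)) volume 0 1 := hc.neg
  simp only [sub_self, zero_smul, sub_zero, intervalIntegral.integral_same, add_zero,
    neg_smul, one_smul] at e
  rw [intervalIntegral.integral_add (intervalIntegrable_of_mem hneg h0 hx)
    (intervalIntegrable_of_mem hc2 h0 hx), intervalIntegral.integral_neg] at e
  rw [eq_comm, ← sub_eq_zero, e]
  abel

end Volterra

/-! ### Construction of the matrix solution from the weighted Volterra equation. -/

section Existence

open scoped BoundedContinuousFunction

variable {N : ℕ} {V : ℝ → Matrix (Fin N) (Fin N) ℂ}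

/-- Local existence in the spectral parameter of the solution with data `ψ(0) = 0`, `ψ'(0) = h`,
with analytic dependence and a uniform bound. -/
theorem exists_isSolution_family (hV : IsPotential V) (h : EuclideanSpace ℂ (Fin N)) (lam₀ : ℂ) :
    ∃ (ψ : ℂ → ℝ → EuclideanSpace ℂ (Fin N)) (C : ℝ),
      (∀ x, DifferentiableAt ℂ (fun lam => ψ lam x) lam₀) ∧
      ∀ᶠ lam in 𝓝 lam₀, (∃ p, IsSolution V lam (ψ lam) p ∧ ψ lam 0 = 0 ∧ p 0 = h) ∧
        ∀ x ∈ Icc (0 : ℝ) 1, ‖ψ lam x‖ ≤ C := by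
  obtain ⟨ρ, f, hfd, hf⟩ := exists_volterra_solution hV.intervalIntegrable h lam₀
  -- Multiplication by e^{ρx} undoes the weight and turns the kernel back into x − t.
  refine ⟨fun lam x => Real.exp (ρ * x) • f lam x, Real.exp |ρ| * (‖f lam₀‖ + 1),
    fun x => ?_, ?_⟩
  · let ev : (ℝ →ᵇ EuclideanSpace ℂ (Fin N)) →L[ℂ] EuclideanSpace ℂ (Fin N) :=
      BoundedContinuousFunction.evalCLM ℂ x
    have : DifferentiableAt ℂ (fun lam => f lam x) lam₀ :=
      (ev.differentiableAt (x := f lam₀)).comp lam₀ hfd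
    exact this.const_smul (Real.exp (ρ * x))
  have hbd : ∀ᶠ lam in 𝓝 lam₀, ‖f lam‖ < ‖f lam₀‖ + 1 :=
    hfd.continuousAt.norm.eventually_lt continuousAt_const (by simp)
  filter_upwards [hf, hbd] with lam hlam hb
  set ψ : ℝ → EuclideanSpace ℂ (Fin N) := fun x => Real.exp (ρ * x) • f lam x with hψ
  have hψc : Continuous ψ := by fun_prop
  have hrhs : IntervalIntegrable (rhs V lam ψ) volume 0 1 := by
    have i1 : IntervalIntegrable (fun t => op (V t) (ψ t)) volume 0 1 := by
      have hop := hV.intervalIntegrable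
      obtain ⟨C, hC⟩ := isCompact_Icc.exists_bound_of_continuousOn
        (hψc.continuousOn (s := Icc (0 : ℝ) 1))
      refine (hop.norm.mul_const C).mono_fun' ?_ ?_
      · exact (isBoundedBilinearMap_apply (𝕜 := ℂ)).continuous.comp_aestronglyMeasurable
          (hop.aestronglyMeasurable_restrict_uIoc.prodMk hψc.aestronglyMeasurable)
      · refine (ae_restrict_mem measurableSet_uIoc).mono fun t ht => ?_
        rw [uIoc_of_le zero_le_one] at ht
        exact ((op (V t)).le_opNorm _).trans
          (mul_le_mul_of_nonneg_left (hC t (Ioc_subset_Icc_self ht)) (norm_nonneg _))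
    exact i1.sub (Continuous.intervalIntegrable (by fun_prop) _ _)
  have key : ∀ x ∈ Icc (0 : ℝ) 1,
      ψ x = x • h + ∫ t in (0 : ℝ)..x, (x - t) • rhs V lam ψ t := by
    intro x hx
    -- The kernel vanishes for t > x, so the integral over [0,1] is an integral over [0,x].
    have split : ∫ t in (0 : ℝ)..1,
        weightKernel ρ (x - t) • (op (V t) (f lam t) - lam • f lam t) =
        ∫ t in (0 : ℝ)..x, weightKernel ρ (x - t) • (op (V t) (f lam t) - lam • f lam t) := by
      rw [intervalIntegral.integral_of_le zero_le_one, intervalIntegral.integral_of_le hx.1]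
      refine (setIntegral_eq_of_subset_of_forall_sdiff_eq_zero measurableSet_Ioc
        (Ioc_subset_Ioc_right hx.2) fun t ht => ?_)
      have : x < t := by
        by_contra hcon
        exact ht.2 ⟨ht.1.1, not_lt.1 hcon⟩
      rw [weightKernel, max_eq_right (by linarith), zero_mul, zero_smul]
    have e := hlam x hx
    rw [split] at e
    simp only [hψ]
    rw [e, smul_add, ← intervalIntegral.integral_smul]
    congr 1
    · rw [smul_smul, weightKernel, max_eq_left hx.1, mul_left_comm, ← Real.exp_add]
      simp
    · refine intervalIntegral.integral_congr fun t ht => ?_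
      rw [uIcc_of_le hx.1] at ht
      simp only [rhs, toEuclideanLin_eq_op]
      rw [smul_smul, weightKernel, max_eq_left (by linarith [ht.2]), mul_left_comm,
        ← Real.exp_add, show ρ * x + -(ρ * (x - t)) = ρ * t by ring, mul_smul]
      congr 1
      rw [smul_sub, ContinuousLinearMap.map_smul_of_tower, smul_comm lam]
  have hψ0 : ψ 0 = 0 := by
    rw [key 0 (by simp)]; simp
  refine ⟨⟨fun x => h + ∫ s in (0 : ℝ)..x, rhs V lam ψ s, ⟨?_, hrhs, fun x hx => ?_,
    fun x hx => ?_⟩, hψ0, by simp⟩, fun x hx => ?_⟩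
  · exact continuousOn_const.add (continuousOn_primitive_unit hrhs)
  · rw [integral_primitive_eq hrhs h hx, hψ0, zero_add]
    exact key x hx
  · simp
  · rw [norm_smul, Real.norm_of_nonneg (Real.exp_pos _).le]
    refine mul_le_mul (Real.exp_le_exp.2 ?_) (((f lam).norm_coe_le_norm x).trans hb.le)
      (norm_nonneg _) (Real.exp_pos _).le
    calc ρ * x ≤ |ρ| * x := by gcongr; exacts [hx.1, le_abs_self ρ]
      _ ≤ |ρ| * 1 := by gcongr; exact hx.2
      _ = |ρ| := mul_one _

theorem IsSolution.sum_smul {lam : ℂ} {ι : Type*} (s : Finset ι) (c : ι → ℂ)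
    {ψ p : ι → ℝ → EuclideanSpace ℂ (Fin N)} (h : ∀ i, IsSolution V lam (ψ i) (p i)) :
    IsSolution V lam (∑ i ∈ s, c i • ψ i) (∑ i ∈ s, c i • p i) := by
  classical
  induction s using Finset.induction_on with
  | empty => simpa using IsSolution.zero V lam
  | insert i s hi ih =>
    rw [Finset.sum_insert hi, Finset.sum_insert hi]
    exact ((h i).smul (c i)).add ih

theorem toEuclideanLin_of_columns (ψ : Fin N → EuclideanSpace ℂ (Fin N))
    (h : EuclideanSpace ℂ (Fin N)) :
    Matrix.toEuclideanLin (Matrix.of fun j i => ψ i j) h = ∑ i, h i • ψ i := by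
  ext j
  simp [Matrix.toLpLin_apply, Matrix.mulVec, dotProduct, mul_comm]

/-- Existence is what gives the choice in `phi` its meaning. The columns are the solutions whose
initial slopes are the unit vectors. -/
theorem isDirichletSolution_phi (hV : IsPotential V) (lam : ℂ) :
    IsDirichletSolution V lam (phi V lam) := by
  refine Classical.epsilon_spec (p := IsDirichletSolution V lam) ?_
  have hex : ∀ i : Fin N, ∃ ψ p : ℝ → EuclideanSpace ℂ (Fin N), IsSolution V lam ψ p ∧
      ψ 0 = 0 ∧ p 0 = EuclideanSpace.single i 1 := by
    intro i
    obtain ⟨ψ, C, -, hψ⟩ := exists_isSolution_family hV (EuclideanSpace.single i 1) lam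
    obtain ⟨⟨p, hp⟩, -⟩ := hψ.self_of_nhds
    exact ⟨ψ lam, p, hp⟩
  choose ψ p hsol hψ0 hp0 using hex
  refine ⟨fun x => Matrix.of fun j i => ψ i x j, fun x => Matrix.of fun j i => p i x j,
    fun h => ?_, ?_, ?_⟩
  · have := IsSolution.sum_smul Finset.univ (fun i => h i) hsol
    convert! this using 1
    · funext x
      simp only [Finset.sum_apply, Pi.smul_apply]
      exact toEuclideanLin_of_columns (fun i => ψ i x) h
    · funext x
      simp only [Finset.sum_apply, Pi.smul_apply]
      exact toEuclideanLin_of_columns (fun i => p i x) h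
  · ext j i; simp [hψ0]
  · ext j i; simp [hp0, Matrix.one_apply]

end Existence

/-! ### The matrix solution -/

section MatrixSolution

variable {N : ℕ} {V : ℝ → Matrix (Fin N) (Fin N) ℂ}

/-- The derivative `φ'(x, lam, V)` of the matrix solution. -/
def dphi (V : ℝ → Matrix (Fin N) (Fin N) ℂ) (lam : ℂ) : ℝ → Matrix (Fin N) (Fin N) ℂ :=
  Classical.epsilon fun P => (∀ h : EuclideanSpace ℂ (Fin N),
      IsSolution V lam (fun x => Matrix.toEuclideanLin (phi V lam x) h)
        (fun x => Matrix.toEuclideanLin (P x) h)) ∧ phi V lam 0 = 0 ∧ P 0 = 1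

theorem dphi_spec (hV : IsPotential V) (lam : ℂ) : (∀ h : EuclideanSpace ℂ (Fin N),
      IsSolution V lam (fun x => op (phi V lam x) h) (fun x => op (dphi V lam x) h)) ∧
      phi V lam 0 = 0 ∧ dphi V lam 0 = 1 :=
  Classical.epsilon_spec (isDirichletSolution_phi hV lam)

theorem isSolution_phi (hV : IsPotential V) (lam : ℂ) (h : EuclideanSpace ℂ (Fin N)) :
    IsSolution V lam (fun x => op (phi V lam x) h) (fun x => op (dphi V lam x) h) :=
  (dphi_spec hV lam).1 h

theorem op_phi_zero (hV : IsPotential V) (lam : ℂ) (h : EuclideanSpace ℂ (Fin N)) :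
    op (phi V lam 0) h = 0 := by
  rw [(dphi_spec hV lam).2.1, op, map_zero]; rfl

theorem op_dphi_zero (hV : IsPotential V) (lam : ℂ) (h : EuclideanSpace ℂ (Fin N)) :
    op (dphi V lam 0) h = h := by
  rw [(dphi_spec hV lam).2.2, op, map_one]; rfl

theorem IsSolution.eq_phi (hV : IsPotential V) {lam : ℂ} {ψ p : ℝ → EuclideanSpace ℂ (Fin N)}
    (h : IsSolution V lam ψ p) (hψ : ψ 0 = 0) {x : ℝ} (hx : x ∈ Icc (0 : ℝ) 1) :
    ψ x = op (phi V lam x) (p 0) := by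
  have h2 := h.add ((isSolution_phi hV lam (p 0)).smul (-1))
  have := h2.eq_zero hV (by simp [hψ, op_phi_zero hV]) (by simp [op_dphi_zero hV]) hx
  simpa [← sub_eq_add_neg, sub_eq_zero] using this

theorem continuousOn_op_phi (hV : IsPotential V) (lam : ℂ) (h : EuclideanSpace ℂ (Fin N)) :
    ContinuousOn (fun x => op (phi V lam x) h) (Icc 0 1) :=
  (isSolution_phi hV lam h).continuousOn

theorem op_single_apply (A : Matrix (Fin N) (Fin N) ℂ) (i j : Fin N) :
    op A (EuclideanSpace.single j 1) i = A i j := by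
  simp [op, Matrix.ofLp_toEuclideanCLM]

/-- The choice in `phi` is made separately for each λ; uniqueness identifies it with the local
analytic families, so the dependence on λ is analytic. -/
theorem differentiableAt_op_phi (hV : IsPotential V) (h : EuclideanSpace ℂ (Fin N)) {x : ℝ}
    (hx : x ∈ Icc (0 : ℝ) 1) (lam₀ : ℂ) :
    DifferentiableAt ℂ (fun lam => op (phi V lam x) h) lam₀ := by
  obtain ⟨ψ, C, hd, hψ⟩ := exists_isSolution_family hV h lam₀
  refine (hd x).congr_of_eventuallyEq ?_
  filter_upwards [hψ] with lam hlam
  obtain ⟨⟨p, hs, h0, hp⟩, -⟩ := hlam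
  rw [hs.eq_phi hV h0 hx, hp]

theorem eventually_norm_op_phi_le (hV : IsPotential V) (h : EuclideanSpace ℂ (Fin N))
    (lam₀ : ℂ) : ∃ C, ∀ᶠ lam in 𝓝 lam₀, ∀ x ∈ Icc (0 : ℝ) 1, ‖op (phi V lam x) h‖ ≤ C := by
  obtain ⟨ψ, C, hd, hψ⟩ := exists_isSolution_family hV h lam₀
  refine ⟨C, ?_⟩
  filter_upwards [hψ] with lam hlam x hx
  obtain ⟨⟨p, hs, h0, hp⟩, hC⟩ := hlam
  have := hC x hx
  rwa [hs.eq_phi hV h0 hx, hp] at this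

/-- The operator `φ(1, lam)`. -/
abbrev mOp (V : ℝ → Matrix (Fin N) (Fin N) ℂ) (lam : ℂ) :
    EuclideanSpace ℂ (Fin N) →L[ℂ] EuclideanSpace ℂ (Fin N) := op (phi V lam 1)

/-- The operator `φ'(1, lam)`. -/
abbrev dOp (V : ℝ → Matrix (Fin N) (Fin N) ℂ) (lam : ℂ) :
    EuclideanSpace ℂ (Fin N) →L[ℂ] EuclideanSpace ℂ (Fin N) := op (dphi V lam 1)

theorem differentiable_mOp (hV : IsPotential V) : Differentiable ℂ (mOp V) := by
  have h : ∀ lam, mOp V lam = ∑ i, ∑ j, phi V lam 1 i j • op (Matrix.single i j 1) :=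
    fun lam => op_eq_sum _
  rw [funext h]
  refine Differentiable.fun_sum fun i _ => Differentiable.fun_sum fun j _ =>
    Differentiable.smul_const (fun lam => ?_) _
  simp_rw [← op_single_apply]
  exact ((EuclideanSpace.proj i : EuclideanSpace ℂ (Fin N) →L[ℂ] ℂ).differentiableAt).comp lam
    (differentiableAt_op_phi hV (EuclideanSpace.single j 1) (by simp) lam)

/-- The matrix `∫₀¹ φ(t, mu)* φ(t, lam) dt`. -/
def gram (V : ℝ → Matrix (Fin N) (Fin N) ℂ) (mu lam : ℂ) : Matrix (Fin N) (Fin N) ℂ :=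
  Matrix.of fun i j => ∫ t in (0 : ℝ)..1, ((phi V mu t)ᴴ * phi V lam t) i j

theorem S_eq_gram (α : ℕ) : S V α = gram V (eigenvalue V α) (eigenvalue V α) := rfl

theorem inner_op_conjTranspose_mul (A B : Matrix (Fin N) (Fin N) ℂ)
    (a b : EuclideanSpace ℂ (Fin N)) :
    inner ℂ (op A a) (op B b) = inner ℂ a (op (Aᴴ * B) b) := by
  have h : op (Aᴴ * B) = ContinuousLinearMap.adjoint (op A) * op B := by
    rw [← Matrix.star_eq_conjTranspose, ← ContinuousLinearMap.star_eq_adjoint, op, map_mul,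
      map_star]
  rw [h, mul_apply_eq_comp, ContinuousLinearMap.adjoint_inner_right]

theorem inner_op_eq_sum (A : Matrix (Fin N) (Fin N) ℂ) (a b : EuclideanSpace ℂ (Fin N)) :
    inner ℂ a (op A b) = ∑ i, ∑ j, A i j * (star (a i) * b j) := by
  simp only [PiLp.inner_apply, op, Matrix.ofLp_toEuclideanCLM, Matrix.mulVec, dotProduct,
    RCLike.inner_apply, Finset.sum_mul]
  refine Finset.sum_congr rfl fun i _ => Finset.sum_congr rfl fun j _ => ?_
  simp only [starRingEnd_apply]
  ring

theorem inner_gram (hV : IsPotential V) (mu lam : ℂ) (a b : EuclideanSpace ℂ (Fin N)) :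
    inner ℂ a (op (gram V mu lam) b) =
      ∫ t in (0 : ℝ)..1, inner ℂ (op (phi V mu t) a) (op (phi V lam t) b) := by
  have hint : ∀ i j, IntervalIntegrable
      (fun t => ((phi V mu t)ᴴ * phi V lam t) i j * (star (a i) * b j)) volume 0 1 := by
    intro i j
    refine IntervalIntegrable.mul_const ?_ _
    refine ContinuousOn.intervalIntegrable ?_
    rw [uIcc_of_le zero_le_one]
    have := ContinuousOn.inner (𝕜 := ℂ) (continuousOn_op_phi hV mu (EuclideanSpace.single i 1))
      (continuousOn_op_phi hV lam (EuclideanSpace.single j 1))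
    refine this.congr fun t _ => ?_
    simp only [inner_op_conjTranspose_mul]
    rw [EuclideanSpace.inner_single_left, op_single_apply]
    simp
  simp_rw [inner_op_conjTranspose_mul, inner_op_eq_sum]
  have hint' : ∀ i, IntervalIntegrable (fun t =>
      ∑ j, ((phi V mu t)ᴴ * phi V lam t) i j * (star (a i) * b j)) volume 0 1 := by
    intro i
    have := IntervalIntegrable.sum Finset.univ (fun j _ => hint i j)
    simpa only [Finset.sum_fn] using this
  rw [intervalIntegral.integral_finsetSum fun i _ => hint' i]
  refine Finset.sum_congr rfl fun i _ => ?_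
  rw [intervalIntegral.integral_finsetSum fun j _ => hint i j]
  refine Finset.sum_congr rfl fun j _ => ?_
  rw [intervalIntegral.integral_mul_const]
  rfl

theorem lagrange (hV : IsPotential V) (mu lam : ℂ) (a b : EuclideanSpace ℂ (Fin N)) :
    inner ℂ (mOp V mu a) (dOp V lam b) - inner ℂ (dOp V mu a) (mOp V lam b) =
      (star mu - lam) * inner ℂ a (op (gram V mu lam) b) := by
  have h := IsSolution.lagrange hV (isSolution_phi hV mu a) (isSolution_phi hV lam b)
    (op_phi_zero hV mu a) (op_phi_zero hV lam b)
  rw [← inner_gram hV mu lam a b] at h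
  exact h

theorem eq_zero_of_op_phi_eq_zero (hV : IsPotential V) {lam : ℂ} {a : EuclideanSpace ℂ (Fin N)}
    (h : ∀ x ∈ Icc (0 : ℝ) 1, op (phi V lam x) a = 0) : a = 0 := by
  have hs := isSolution_phi hV lam a
  have hp : ∀ x ∈ Icc (0 : ℝ) 1, op (dphi V lam x) a = a := by
    intro x hx
    rw [hs.4 x hx, op_dphi_zero hV, intervalIntegral.integral_congr (g := fun _ => 0)]
    · simp
    · intro t ht
      rw [uIcc_of_le hx.1] at ht
      simp [rhs, h t ⟨ht.1, ht.2.trans hx.2⟩]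
  have h1 := hs.3 1 (by simp)
  rw [h 1 (by simp), h 0 (by simp), zero_add, intervalIntegral.integral_congr (g := fun _ => a)]
    at h1
  · simpa using h1.symm
  · intro t ht
    rw [uIcc_of_le zero_le_one] at ht
    exact hp t ht

/-- Positive definiteness of S: the form is ∫ ‖φ(t)a‖² dt, so its vanishing forces φ(·)a = 0 on
[0,1] and then a = φ'(0)a = 0. -/
theorem eq_zero_of_inner_gram_self (hV : IsPotential V) {lam : ℂ}
    {a : EuclideanSpace ℂ (Fin N)} (h : inner ℂ a (op (gram V lam lam) a) = 0) : a = 0 := by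
  rw [inner_gram hV] at h
  simp_rw [inner_self_eq_norm_sq_to_K] at h
  have h' : ∫ t in (0 : ℝ)..1, ‖op (phi V lam t) a‖ ^ 2 = 0 := by
    have := intervalIntegral.integral_ofReal (f := fun t => ‖op (phi V lam t) a‖ ^ 2)
      (a := 0) (b := 1) (μ := volume)
    rw [← Complex.ofReal_inj, ← this]
    simpa using h
  refine eq_zero_of_op_phi_eq_zero hV (lam := lam) fun x hx => ?_
  by_contra hne
  refine (intervalIntegral.integral_pos one_pos ((continuousOn_op_phi hV lam a).norm.pow 2)
    (fun t _ => sq_nonneg _) ⟨x, hx, pow_pos (norm_pos_iff.2 hne) 2⟩).ne' h'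

theorem continuous_gram (hV : IsPotential V) (mu : ℂ) :
    Continuous fun lam => op (gram V mu lam) := by
  have h : ∀ lam, op (gram V mu lam) =
      ∑ i, ∑ j, gram V mu lam i j • op (Matrix.single i j 1) := fun lam => op_eq_sum _
  rw [funext h]
  refine continuous_finsetSum _ fun i _ => continuous_finsetSum _ fun j _ =>
    Continuous.fun_smul ?_ continuous_const
  have e : ∀ lam, gram V mu lam i j = ∫ t in (0 : ℝ)..1,
      inner ℂ (op (phi V mu t) (EuclideanSpace.single i 1))
        (op (phi V lam t) (EuclideanSpace.single j 1)) := by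
    intro lam
    rw [← inner_gram hV, EuclideanSpace.inner_single_left, op_single_apply]
    simp
  simp_rw [e]
  refine continuous_iff_continuousAt.2 fun lam₀ => ?_
  obtain ⟨C, hC⟩ := eventually_norm_op_phi_le hV (EuclideanSpace.single j 1) lam₀
  have hmu := continuousOn_op_phi hV mu (EuclideanSpace.single i 1)
  refine intervalIntegral.continuousAt_of_dominated_interval
    (bound := fun t => ‖op (phi V mu t) (EuclideanSpace.single i 1)‖ * C) ?_ ?_ ?_ ?_
  · refine Eventually.of_forall fun lam => ?_
    refine ContinuousOn.aestronglyMeasurable ?_ measurableSet_uIoc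
    rw [uIoc_of_le zero_le_one]
    exact (hmu.inner (continuousOn_op_phi hV lam _)).mono Ioc_subset_Icc_self
  · filter_upwards [hC] with lam hlam
    refine Eventually.of_forall fun t ht => (norm_inner_le_norm _ _).trans ?_
    rw [uIoc_of_le zero_le_one] at ht
    exact mul_le_mul_of_nonneg_left (hlam t (Ioc_subset_Icc_self ht)) (norm_nonneg _)
  · refine ContinuousOn.intervalIntegrable ?_
    rw [uIcc_of_le zero_le_one]
    exact hmu.norm.mul continuousOn_const
  · refine Eventually.of_forall fun t ht => ?_
    rw [uIoc_of_le zero_le_one] at ht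
    exact continuousAt_const.inner
      (differentiableAt_op_phi hV _ (Ioc_subset_Icc_self ht) lam₀).continuousAt

/-! ### Asymptotics -/

theorem norm_mOp_sq_le (hV : IsPotential V) {z : ℂ} (hz : z ≠ 0)
    (hzV : 2 * potentialNorm V ≤ ‖z‖) : ‖mOp V (z ^ 2)‖ ≤ 2 / ‖z‖ * Real.exp |z.im| := by
  refine ContinuousLinearMap.opNorm_le_bound _ (by positivity) fun w => ?_
  have := ((isSolution_phi hV (z ^ 2) w).asymptotics hV hz (op_phi_zero hV _ _) hzV).1
  rw [op_dphi_zero hV] at this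
  refine this.trans (le_of_eq ?_)
  ring

/-- The main term (sin z / z)w has norm at least e^{|Im z|}‖w‖/(4|z|); the constant 16 makes the
error at most half of this. -/
theorem le_norm_mOp_sq (hV : IsPotential V) {z : ℂ} (hz : z ≠ 0)
    (hzV : 16 * potentialNorm V ≤ ‖z‖) (hsin : Real.exp |z.im| / 4 ≤ ‖Complex.sin z‖)
    (w : EuclideanSpace ℂ (Fin N)) :
    Real.exp |z.im| / (8 * ‖z‖) * ‖w‖ ≤ ‖mOp V (z ^ 2) w‖ := by
  have hn := potentialNorm_nonneg V
  have hz' : 0 < ‖z‖ := norm_pos_iff.2 hz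
  have key := ((isSolution_phi hV (z ^ 2) w).asymptotics hV hz (op_phi_zero hV _ _)
    (by linarith)).2
  rw [op_dphi_zero hV] at key
  have h1 : ‖(Complex.sin z / z) • w‖ ≤ ‖mOp V (z ^ 2) w‖ +
      ‖mOp V (z ^ 2) w - (Complex.sin z / z) • w‖ := norm_le_insert _ _
  rw [norm_smul, norm_div] at h1
  have h2 : Real.exp |z.im| / 4 / ‖z‖ * ‖w‖ ≤ ‖Complex.sin z‖ / ‖z‖ * ‖w‖ := by gcongr
  have h3 : 2 * ‖w‖ / ‖z‖ ^ 2 * potentialNorm V * Real.exp |z.im| ≤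
      Real.exp |z.im| / (8 * ‖z‖) * ‖w‖ := by
    calc 2 * ‖w‖ / ‖z‖ ^ 2 * potentialNorm V * Real.exp |z.im|
        ≤ 2 * ‖w‖ / ‖z‖ ^ 2 * (‖z‖ / 16) * Real.exp |z.im| := by gcongr; linarith
      _ = _ := by field_simp; ring
  have h4 : Real.exp |z.im| / 4 / ‖z‖ * ‖w‖ = 2 * (Real.exp |z.im| / (8 * ‖z‖) * ‖w‖) := by
    field_simp; ring
  linarith

/-- Serves on the horizontal sides of the squares, and on the imaginary axis for the lower bound of
the spectrum. Since e ≥ 2, the smaller exponential is at most half the larger one. -/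
theorem exp_div_four_le_norm_sin_of_one_le {z : ℂ} (hz : 1 ≤ |z.im|) :
    Real.exp |z.im| / 4 ≤ ‖Complex.sin z‖ := by
  rw [Complex.sin, norm_div, norm_mul, Complex.norm_I, mul_one, Complex.norm_ofNat]
  have h1 : ‖Complex.exp (-z * Complex.I)‖ = Real.exp z.im := by simp [Complex.norm_exp]
  have h2 : ‖Complex.exp (z * Complex.I)‖ = Real.exp (-z.im) := by simp [Complex.norm_exp]
  have h3 := abs_norm_sub_norm_le (Complex.exp (-z * Complex.I)) (Complex.exp (z * Complex.I))
  rw [h1, h2] at h3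
  have h4 : Real.exp |z.im| - Real.exp (-|z.im|) ≤ |Real.exp z.im - Real.exp (-z.im)| := by
    rcases abs_cases z.im with ⟨h, -⟩ | ⟨h, -⟩ <;> rw [h]
    · exact le_abs_self _
    · rw [neg_neg, abs_sub_comm]; exact le_abs_self _
  have h5 : Real.exp (-|z.im|) ≤ Real.exp |z.im| / 2 := by
    have e1 : Real.exp (-|z.im|) ≤ 1 := by simp
    have e2 := Real.add_one_le_exp |z.im|
    linarith
  linarith

/-- Serves on the vertical sides of the squares, where |sin z| = cosh(Im z). -/
theorem exp_div_four_le_norm_sin_of_cos_eq_zero {z : ℂ} (hz : Real.cos z.re = 0) :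
    Real.exp |z.im| / 4 ≤ ‖Complex.sin z‖ := by
  have hs : |Real.sin z.re| = 1 := by
    have := Real.sin_sq_add_cos_sq z.re
    rw [hz] at this
    rw [← sq_eq_sq₀ (abs_nonneg _) zero_le_one, sq_abs]; linarith
  have h1 : Complex.sin z = (Real.sin z.re : ℂ) * (Real.cosh z.im : ℂ) := by
    conv_lhs => rw [← Complex.re_add_im z, Complex.sin_add_mul_I]
    rw [← Complex.ofReal_cos, hz]
    simp
  rw [h1, norm_mul, Complex.norm_real, Complex.norm_real, Real.norm_eq_abs, hs, one_mul,
    Real.norm_of_nonneg (Real.cosh_pos _).le, ← Real.cosh_abs, Real.cosh_eq]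
  have := Real.exp_pos (-|z.im|)
  have := Real.exp_pos (|z.im|)
  linarith

/-! ### Invertibility of `φ(1, lam)` -/

theorem isUnit_clm_of_ker {A : EuclideanSpace ℂ (Fin N) →L[ℂ] EuclideanSpace ℂ (Fin N)}
    (h : ∀ x, A x = 0 → x = 0) : IsUnit A := by
  have hi : Function.Injective A := (injective_iff_map_eq_zero A).2 h
  rw [ContinuousLinearMap.isUnit_iff_bijective]
  exact ⟨hi, (LinearMap.injective_iff_surjective (f := A.toLinearMap)).1 hi⟩

/-- Self-adjointness: for a in the kernel the Lagrange identity with equal parameters leaves (λ̄ −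
λ)⟨a, Ga⟩ = 0. -/
theorem isUnit_mOp_of_not_real (hV : IsPotential V) {lam : ℂ} (h : star lam ≠ lam) :
    IsUnit (mOp V lam) := by
  refine isUnit_clm_of_ker fun a ha => eq_zero_of_inner_gram_self hV (lam := lam) ?_
  have := lagrange hV lam lam a a
  rw [ha, inner_zero_left, inner_zero_right, sub_zero, eq_comm, mul_eq_zero] at this
  exact this.resolve_left (sub_ne_zero.2 h)

/-- The inverse of `φ(1, lam)` has at most simple poles. -/
theorem eventually_isUnit_mOp (hV : IsPotential V) (mu : ℝ) :
    ∃ C : ℝ, ∀ᶠ lam in 𝓝[≠] (mu : ℂ), IsUnit (mOp V lam) ∧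
      ‖Ring.inverse (mOp V lam)‖ ≤ C / ‖lam - mu‖ := by
  set A := mOp V mu with hA
  set P : EuclideanSpace ℂ (Fin N) →L[ℂ] EuclideanSpace ℂ (Fin N) :=
    (LinearMap.ker A.toLinearMap).starProjection with hP
  set L := ContinuousLinearMap.adjoint (dOp V mu * P) with hL
  -- By the Lagrange identity K(λ) = (A* + (λ − μ)⁻¹L)M(λ), where P projects onto Ker A. Since K is
  -- continuous and K(μ) is invertible, M(λ)⁻¹ = K(λ)⁻¹(A* + (λ − μ)⁻¹L) near μ, which shows the
  -- order of the pole.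
  set K : ℂ → EuclideanSpace ℂ (Fin N) →L[ℂ] EuclideanSpace ℂ (Fin N) := fun lam =>
    ContinuousLinearMap.adjoint A * mOp V lam + P * op (gram V mu lam) with hK
  have hAP : ∀ x, A (P x) = 0 := fun x =>
    (Submodule.starProjection_apply_mem (LinearMap.ker A.toLinearMap) x)
  have hPs : ∀ x y, inner ℂ x (P y) = inner ℂ (P x) y := fun x y =>
    (Submodule.inner_starProjection_left_eq_right _ x y).symm
  have hKc : Continuous K :=
    (continuous_const.mul (differentiable_mOp hV).continuous).add
      (continuous_const.mul (continuous_gram hV mu))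
  have hK0 : IsUnit (K mu) := by
    refine isUnit_clm_of_ker fun x hx => ?_
    have hAx : A x = 0 := by
      -- Pairing with A*Ax removes the second summand of K(μ)x, because AP = 0.
      have h1 : inner ℂ (A.adjoint (A x)) (K mu x) = 0 := by rw [hx, inner_zero_right]
      have h2 : inner ℂ (A.adjoint (A x)) (P (op (gram V mu mu) x)) = 0 := by
        rw [ContinuousLinearMap.adjoint_inner_left, hAP, inner_zero_right]
      have h3 : inner ℂ (A.adjoint (A x)) (A.adjoint (A x)) = 0 := by
        rw [hK] at h1
        simp only [add_apply, mul_apply_eq_comp, inner_add_right] at h1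
        rwa [h2, add_zero] at h1
      rw [inner_self_eq_zero] at h3
      have h4 : inner ℂ (A x) (A x) = 0 := by
        rw [← ContinuousLinearMap.adjoint_inner_left, h3, inner_zero_left]
      exact inner_self_eq_zero.1 h4
    have hPx : P x = x := Submodule.starProjection_eq_self_iff.2 hAx
    refine eq_zero_of_inner_gram_self hV (lam := mu) ?_
    have h5 : P (op (gram V mu mu) x) = 0 := by
      have : K mu x = 0 := hx
      rw [hK] at this
      simp only [add_apply, mul_apply_eq_comp] at this
      rwa [← hA, hAx, map_zero, zero_add] at this
    rw [← hPx, ← hPs, hPx, h5, inner_zero_right]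
  have hfac : ∀ lam : ℂ, lam ≠ mu →
      K lam = (ContinuousLinearMap.adjoint A + (lam - mu)⁻¹ • L) * mOp V lam := by
    intro lam hlam
    have h1 : P * op (gram V mu lam) = (lam - mu)⁻¹ • (L * mOp V lam) := by
      rw [eq_inv_smul_iff₀ (sub_ne_zero.2 hlam)]
      ext1 b
      refine ext_inner_left ℂ fun a => ?_
      have := lagrange hV mu lam (P a) b
      rw [← hA, hAP, inner_zero_left, zero_sub] at this
      simp only [smul_apply, mul_apply_eq_comp, inner_smul_right, hL,
        ContinuousLinearMap.adjoint_inner_right]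
      rw [hPs]
      have hs : star (mu : ℂ) = mu := Complex.conj_ofReal mu
      rw [hs] at this
      linear_combination this
    simp only [hK, add_mul, smul_mul_assoc]
    rw [h1]
  obtain ⟨u, hu⟩ := hK0
  have hinvc : ContinuousAt (fun lam => Ring.inverse (K lam)) (mu : ℂ) := by
    have := NormedRing.inverse_continuousAt u
    rw [hu] at this
    exact ContinuousAt.comp (f := K) (x := (mu : ℂ)) this hKc.continuousAt
  have e1 : ∀ᶠ lam in 𝓝 (mu : ℂ), IsUnit (K lam) := by
    have : {A | IsUnit A} ∈ 𝓝 (K mu) := by rw [← hu]; exact Units.nhds u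
    exact hKc.continuousAt this
  set M := ‖Ring.inverse (K mu)‖ + 1 with hM
  have e2 : ∀ᶠ lam in 𝓝 (mu : ℂ), ‖Ring.inverse (K lam)‖ < M :=
    hinvc.norm.eventually_lt continuousAt_const (by simp [hM])
  have e3 : ∀ᶠ lam : ℂ in 𝓝 (mu : ℂ), ‖lam - mu‖ < 1 :=
    ContinuousAt.eventually_lt (by fun_prop) continuousAt_const (by simp)
  refine ⟨M * (‖ContinuousLinearMap.adjoint A‖ + ‖L‖), ?_⟩
  filter_upwards [nhdsWithin_le_nhds e1, nhdsWithin_le_nhds e2, nhdsWithin_le_nhds e3,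
    self_mem_nhdsWithin] with lam h1 h2 h3 (h4 : lam ≠ mu)
  have hpos : 0 < ‖lam - mu‖ := norm_pos_iff.2 (sub_ne_zero.2 h4)
  have hinv : (Ring.inverse (K lam) *
      (ContinuousLinearMap.adjoint A + (lam - mu)⁻¹ • L)) * mOp V lam = 1 := by
    rw [mul_assoc, ← hfac lam h4, Ring.inverse_mul_cancel _ h1]
  have hm : IsUnit (mOp V lam) := by
    refine isUnit_clm_of_ker fun x hx => ?_
    have := congrArg (fun B => B x) hinv
    simpa [hx] using this.symm
  refine ⟨hm, ?_⟩
  have hR : Ring.inverse (mOp V lam) = Ring.inverse (K lam) *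
      (ContinuousLinearMap.adjoint A + (lam - mu)⁻¹ • L) := by
    rw [← one_mul (Ring.inverse (mOp V lam)), ← hinv, mul_assoc _ (mOp V lam),
      Ring.mul_inverse_cancel _ hm, mul_one]
  rw [hR]
  calc ‖Ring.inverse (K lam) * (ContinuousLinearMap.adjoint A + (lam - mu)⁻¹ • L)‖
      ≤ M * (‖ContinuousLinearMap.adjoint A‖ + ‖lam - mu‖⁻¹ * ‖L‖) := by
        refine (norm_mul_le _ _).trans (mul_le_mul h2.le ((norm_add_le _ _).trans ?_)
          (norm_nonneg _) (by positivity))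
        rw [norm_smul, norm_inv]
    _ ≤ M * (‖lam - mu‖⁻¹ * ‖ContinuousLinearMap.adjoint A‖ + ‖lam - mu‖⁻¹ * ‖L‖) := by
        gcongr
        exact le_mul_of_one_le_left (norm_nonneg _) ((one_le_inv₀ hpos).2 h3.le)
    _ = _ := by ring

/-! ### The eigenvalues -/

theorem IsSolution.congr {lam : ℂ} {ψ χ p : ℝ → EuclideanSpace ℂ (Fin N)}
    (h : IsSolution V lam ψ p) (hχ : ∀ x ∈ Icc (0 : ℝ) 1, χ x = ψ x) :
    IsSolution V lam χ p := by
  have hr : ∀ x ∈ Icc (0 : ℝ) 1, rhs V lam χ x = rhs V lam ψ x := fun x hx => by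
    simp only [rhs, hχ x hx]
  refine ⟨h.1, h.2.congr fun t ht => ?_, fun x hx => ?_, fun x hx => ?_⟩
  · rw [uIoc_of_le zero_le_one] at ht
    exact (hr t (Ioc_subset_Icc_self ht)).symm
  · rw [hχ x hx, hχ 0 (by simp)]; exact h.3 x hx
  · rw [h.4 x hx]
    congr 1
    refine intervalIntegral.integral_congr fun t ht => (hr t ?_).symm
    rw [uIcc_of_le hx.1] at ht
    exact ⟨ht.1, ht.2.trans hx.2⟩

/-- A solution vanishing at 0 is φ(·, μ)a with a its initial slope, so eigenfunctions correspond to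
kernel vectors of φ(1, μ). -/
theorem mem_eigenvalues_iff (hV : IsPotential V) {mu : ℝ} :
    mu ∈ eigenvalues V ↔ ¬ IsUnit (mOp V mu) := by
  constructor
  · intro h hu
    obtain ⟨ψ, ⟨hout, h0, h1, p, hs⟩, hne⟩ := (Submodule.ne_bot_iff _).1 h
    refine hne (funext fun x => ?_)
    have hp : p 0 = 0 := by
      rw [hs.eq_phi hV h0 (by simp)] at h1
      rw [ContinuousLinearMap.isUnit_iff_bijective] at hu
      exact (injective_iff_map_eq_zero (mOp V mu)).1 hu.1 _ h1
    by_cases hx : x ∈ Icc (0 : ℝ) 1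
    · rw [hs.eq_phi hV h0 hx, hp, map_zero]; rfl
    · exact hout x hx
  · intro h
    have hex : ∃ a, mOp V mu a = 0 ∧ a ≠ 0 := by
      by_contra hcon
      push Not at hcon
      exact h (isUnit_clm_of_ker hcon)
    obtain ⟨a, ha, hne⟩ := hex
    have e : ∀ x ∈ Icc (0 : ℝ) 1,
        (Icc (0 : ℝ) 1).indicator (fun x => op (phi V mu x) a) x = op (phi V mu x) a :=
      fun x hx => indicator_of_mem hx _
    refine (Submodule.ne_bot_iff _).2 ⟨(Icc (0 : ℝ) 1).indicator fun x => op (phi V mu x) a,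
      ⟨fun x hx => indicator_of_notMem hx _, ?_, ?_, _, (isSolution_phi hV mu a).congr e⟩, ?_⟩
    · rw [e 0 (by simp), op_phi_zero hV]
    · rw [e 1 (by simp), ha]
    · intro h0
      refine hne (eq_zero_of_op_phi_eq_zero hV (lam := mu) fun x hx => ?_)
      rw [← e x hx, h0]; rfl

/-- For μ = (iy)² with y large the sine dominates, and φ(1, μ) is injective. -/
theorem bddBelow_eigenvalues (hV : IsPotential V) : BddBelow (eigenvalues V) := by
  have hn := potentialNorm_nonneg V
  set Y : ℝ := 16 * potentialNorm V + 1 with hY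
  refine ⟨-Y ^ 2, fun mu hmu => ?_⟩
  by_contra hlt
  push Not at hlt
  refine (mem_eigenvalues_iff hV).1 hmu ?_
  set y := Real.sqrt (-mu) with hy
  have hyY : Y ≤ y := Real.le_sqrt_of_sq_le (by linarith)
  have hz : (mu : ℂ) = ((y : ℂ) * Complex.I) ^ 2 := by
    rw [mul_pow, Complex.I_sq, ← Complex.ofReal_pow, hy, Real.sq_sqrt (by nlinarith)]
    push_cast; ring
  have hy1 : 1 ≤ y := by linarith
  have hnz : ‖(y : ℂ) * Complex.I‖ = y := by
    rw [norm_mul, Complex.norm_I, mul_one, Complex.norm_real, Real.norm_of_nonneg (by linarith)]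
  rw [hz]
  refine isUnit_clm_of_ker fun w hw => ?_
  have hz0 : (y : ℂ) * Complex.I ≠ 0 := by rw [← norm_pos_iff, hnz]; linarith
  have key := le_norm_mOp_sq hV hz0 (by rw [hnz]; linarith)
    (exp_div_four_le_norm_sin_of_one_le (by simpa using hy1.trans (le_abs_self y))) w
  rw [hw, norm_zero] at key
  by_contra hne
  have : 0 < ‖w‖ := norm_pos_iff.2 hne
  have : 0 < ‖(y : ℂ) * Complex.I‖ := by rw [hnz]; linarith
  exact absurd key (not_le.2 (by positivity))

/-- Infinitely many eigenvalues in a compact interval would accumulate, against invertibility of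
φ(1, λ) in punctured neighbourhoods. -/
theorem finite_eigenvalues_le (hV : IsPotential V) (mu : ℝ) :
    {ν | ν ∈ eigenvalues V ∧ ν ≤ mu}.Finite := by
  obtain ⟨b, hb⟩ := bddBelow_eigenvalues hV
  by_contra hinf
  obtain ⟨x, -, hx⟩ := Set.Infinite.exists_accPt_of_subset_isCompact hinf
    (isCompact_Icc (a := b) (b := mu)) fun ν hν => ⟨hb hν.1, hν.2⟩
  obtain ⟨C, hC⟩ := eventually_isUnit_mOp hV x
  have ht : Tendsto (fun y : ℝ => (y : ℂ)) (𝓝[≠] x) (𝓝[≠] (x : ℂ)) :=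
    tendsto_nhdsWithin_of_tendsto_nhds_of_eventually_within _
      (Complex.continuous_ofReal.continuousAt.tendsto.mono_left nhdsWithin_le_nhds)
      (by filter_upwards [self_mem_nhdsWithin] with y hy using by simpa using hy)
  rw [accPt_iff_frequently_nhdsNE] at hx
  obtain ⟨y, hy1, hy2⟩ := (hx.and_eventually (ht.eventually hC)).exists
  exact (mem_eigenvalues_iff hV).1 hy1.1 hy2.1

/-- Every element of a discrete set bounded below is found by the enumeration. -/
theorem exists_eigenvalue_eq (hV : IsPotential V) {mu : ℝ} (hmu : mu ∈ eigenvalues V) :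
    ∃ n, eigenvalue V n = mu := by
  -- As long as the set contains `mu`, its infimum is attained, so no default value of `sInf` enters
  -- the enumeration.
  have least : ∀ s : Set ℝ, s ⊆ eigenvalues V → mu ∈ s → sInf s ∈ s ∧ sInf s ≤ mu := by
    intro s hs hm
    have hbdd : BddBelow s := (bddBelow_eigenvalues hV).mono hs
    have hle : sInf s ≤ mu := csInf_le hbdd hm
    have hfin : {ν | ν ∈ s ∧ ν ≤ mu}.Finite :=
      (finite_eigenvalues_le hV mu).subset fun ν hν => ⟨hs hν.1, hν.2⟩
    obtain ⟨ν, hν, hmin⟩ := hfin.exists_minimal ⟨mu, hm, le_rfl⟩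
    have : IsLeast s ν := ⟨hν.1, fun y hy => by
      rcases le_total y mu with h | h
      · rcases le_total ν y with h' | h'
        · exact h'
        · exact hmin ⟨hy, h⟩ h'
      · exact hν.2.trans h⟩
    rw [this.csInf_eq]
    exact hν
  -- An enumeration that misses `mu` would stay below it and increase strictly, through a finite
  -- set.
  by_contra hcon
  push Not at hcon
  have step : ∀ n, eigenvalue V n ∈ eigenvalues V ∧ eigenvalue V n < mu := by
    intro n
    induction n with
    | zero =>
      have := least _ subset_rfl hmu
      exact ⟨this.1, lt_of_le_of_ne this.2 (hcon 0)⟩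
    | succ n ih =>
      have := least {ν | ν ∈ eigenvalues V ∧ eigenvalue V n < ν} (fun ν hν => hν.1) ⟨hmu, ih.2⟩
      exact ⟨this.1.1, lt_of_le_of_ne this.2 (hcon (n + 1))⟩
  have mono : StrictMono (eigenvalue V) := strictMono_nat_of_lt_succ fun n =>
    (least {ν | ν ∈ eigenvalues V ∧ eigenvalue V n < ν} (fun ν hν => hν.1)
      ⟨hmu, (step n).2⟩).1.2
  exact Set.infinite_of_injective_forall_mem mono.injective
    (fun n => (⟨(step n).1, (step n).2.le⟩ : eigenvalue V n ∈ {ν | ν ∈ eigenvalues V ∧ ν ≤ mu}))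
    (finite_eigenvalues_le hV mu)

end MatrixSolution

/-! ### Removable singularities and the Liouville argument -/

section Liouville

/-- A function with isolated, locally bounded singularities extends to an entire function. -/
theorem exists_entire_extension {F : Type*} [NormedAddCommGroup F] [NormedSpace ℂ F]
    [CompleteSpace F] {G : ℂ → F} (hd : ∀ z, ∀ᶠ w in 𝓝[≠] z, DifferentiableAt ℂ G w)
    (hb : ∀ z, ∃ C, ∀ᶠ w in 𝓝[≠] z, ‖G w‖ ≤ C) :
    ∃ g : ℂ → F, Differentiable ℂ g ∧ ∀ z, ContinuousAt G z → g z = G z := by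
  have hg : ∀ z, ContinuousAt G z → limUnder (𝓝[≠] z) G = G z := fun z hz =>
    (hz.tendsto.mono_left nhdsWithin_le_nhds).limUnder_eq
  refine ⟨fun z => limUnder (𝓝[≠] z) G, fun z => ?_, hg⟩
  obtain ⟨C, hC⟩ := hb z
  obtain ⟨s, hs, hsub⟩ := mem_nhdsWithin_iff_exists_mem_nhds_inter.1 ((hd z).and hC)
  have hsub' : ∀ w ∈ s \ {z}, DifferentiableAt ℂ G w ∧ ‖G w‖ ≤ C := fun w hw => hsub hw
  have h := Complex.differentiableOn_update_limUnder_of_bddAbove hs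
    (fun w hw => (hsub' w hw).1.differentiableWithinAt)
    ⟨C, by rintro _ ⟨w, hw, rfl⟩; exact (hsub' w hw).2⟩
  refine (h.differentiableAt hs).congr_of_eventuallyEq ?_
  filter_upwards [hs] with w hw
  rcases eq_or_ne w z with rfl | hne
  · simp
  · rw [Function.update_of_ne hne]
    exact hg w (hsub' w ⟨hw, hne⟩).1.continuousAt

/-- An entire function of `z ^ 2` that is bounded on the boundaries of large squares with
half-integer (times `π`) sides is constant. -/
theorem eq_of_bounded_on_squares {F : Type*} [NormedAddCommGroup F] [NormedSpace ℂ F]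
    {g : ℂ → F} (hg : Differentiable ℂ g) {B C : ℝ}
    (h : ∀ z : ℂ, B ≤ ‖z‖ → (Real.cos z.re = 0 ∨ 1 ≤ |z.im|) → ‖g (z ^ 2)‖ ≤ C) (lam : ℂ) :
    g lam = g 0 := by
  have hf : Differentiable ℂ fun z : ℂ => g (z ^ 2) := hg.comp (by fun_prop)
  have hbound : ∀ z : ℂ, ‖g (z ^ 2)‖ ≤ C := by
    intro z₀
    obtain ⟨n, hn⟩ := exists_nat_gt (max B ‖z₀‖)
    -- A zero of the cosine beyond both B and ‖z₀‖.
    set a : ℝ := (2 * (n : ℤ) + 1) * Real.pi / 2 with ha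
    have hpi := Real.pi_gt_three
    have hn0 : (0 : ℝ) ≤ n := n.cast_nonneg
    have han : n + 1 ≤ a := by rw [ha]; push_cast; nlinarith
    have hcos : Real.cos a = 0 := Real.cos_eq_zero_iff.2 ⟨n, rfl⟩
    have hlt : -a < a := by linarith
    have hfr : ∀ z ∈ frontier (Ioo (-a) a ×ℂ Ioo (-a) a), ‖g (z ^ 2)‖ ≤ C := by
      intro z hz
      rw [Complex.frontier_reProdIm, closure_Ioo hlt.ne, frontier_Ioo hlt] at hz
      have hBn : B < n := (le_max_left _ _).trans_lt hn
      rcases hz with ⟨-, him⟩ | ⟨hre, -⟩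
      · have him : |z.im| = a := by
          rcases him with h | h
          · rw [h, abs_neg, abs_of_pos (by linarith)]
          · rw [h, abs_of_pos (by linarith)]
        refine h z ?_ (Or.inr (by linarith))
        linarith [Complex.abs_im_le_norm z]
      · have hre' : |z.re| = a ∧ Real.cos z.re = 0 := by
          rcases hre with h | h
          · rw [h, abs_neg, abs_of_pos (by linarith), Real.cos_neg]; exact ⟨rfl, hcos⟩
          · rw [h, abs_of_pos (by linarith)]; exact ⟨rfl, hcos⟩
        refine h z ?_ (Or.inl hre'.2)
        linarith [Complex.abs_re_le_norm z]
    refine Complex.norm_le_of_forall_mem_frontier_norm_le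
      ((Metric.isBounded_Ioo (-a) a).reProdIm (Metric.isBounded_Ioo (-a) a))
      hf.diffContOnCl hfr (subset_closure ?_)
    have hz₀ : ‖z₀‖ < a := by linarith [le_max_right B ‖z₀‖]
    exact ⟨abs_lt.1 ((Complex.abs_re_le_norm z₀).trans_lt hz₀),
      abs_lt.1 ((Complex.abs_im_le_norm z₀).trans_lt hz₀)⟩
  have hconst := hf.apply_eq_apply_of_bounded
    (isBounded_iff_forall_norm_le.2 ⟨C, by rintro _ ⟨z, rfl⟩; exact hbound z⟩)
    (lam ^ ((2 : ℕ) : ℂ)⁻¹) 0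
  simpa [Complex.cpow_nat_inv_pow lam two_ne_zero] using hconst

end Liouville

/-! ### Comparison of the rows of φ(1, λ) for two potentials. -/

section Factorization

variable {N : ℕ} {V W : ℝ → Matrix (Fin N) (Fin N) ℂ}

theorem eventually_isUnit_mOp_nhdsNE (hV : IsPotential V) (z : ℂ) :
    ∀ᶠ w in 𝓝[≠] z, IsUnit (mOp V w) := by
  by_cases hz : star z = z
  · obtain ⟨mu, rfl⟩ : ∃ mu : ℝ, z = mu := ⟨z.re, (Complex.conj_eq_iff_re.1 hz).symm⟩
    obtain ⟨C, hC⟩ := eventually_isUnit_mOp hV mu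
    exact hC.mono fun w hw => hw.1
  · obtain ⟨u, hu⟩ := isUnit_mOp_of_not_real hV hz
    have : {A | IsUnit A} ∈ 𝓝 (mOp V z) := by rw [← hu]; exact Units.nhds u
    exact nhdsWithin_le_nhds ((differentiable_mOp hV).continuous.continuousAt this)

theorem norm_inverse_mOp_sq_le (hV : IsPotential V) {z : ℂ} (hz : z ≠ 0)
    (hzV : 16 * potentialNorm V ≤ ‖z‖) (hsin : Real.exp |z.im| / 4 ≤ ‖Complex.sin z‖) :
    IsUnit (mOp V (z ^ 2)) ∧
      ‖Ring.inverse (mOp V (z ^ 2))‖ ≤ 8 * ‖z‖ / Real.exp |z.im| := by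
  have hz' : 0 < ‖z‖ := norm_pos_iff.2 hz
  have hu : IsUnit (mOp V (z ^ 2)) := by
    refine isUnit_clm_of_ker fun w hw => ?_
    have key := le_norm_mOp_sq hV hz hzV hsin w
    rw [hw, norm_zero] at key
    by_contra hne
    have : 0 < ‖w‖ := norm_pos_iff.2 hne
    exact absurd key (not_le.2 (by positivity))
  refine ⟨hu, ContinuousLinearMap.opNorm_le_bound _ (by positivity) fun x => ?_⟩
  have key := le_norm_mOp_sq hV hz hzV hsin (Ring.inverse (mOp V (z ^ 2)) x)
  rw [← mul_apply_eq_comp, Ring.mul_inverse_cancel _ hu, one_apply_eq_self] at key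
  have hpos : 0 < Real.exp |z.im| / (8 * ‖z‖) := by positivity
  rw [← le_div_iff₀' hpos] at key
  refine key.trans (le_of_eq ?_)
  field_simp

/-- In finite dimension the range of the transpose is the annihilator of the kernel. -/
theorem exists_clm_factor {A : EuclideanSpace ℂ (Fin N) →L[ℂ] EuclideanSpace ℂ (Fin N)}
    {r : EuclideanSpace ℂ (Fin N) →L[ℂ] ℂ} (h : ∀ x, A x = 0 → r x = 0) :
    ∃ y : EuclideanSpace ℂ (Fin N) →L[ℂ] ℂ, r = y ∘L A := by
  have hmem : r.toLinearMap ∈ LinearMap.range A.toLinearMap.dualMap := by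
    rw [LinearMap.range_dualMap_eq_dualAnnihilator_ker, Submodule.mem_dualAnnihilator]
    exact fun x hx => h x hx
  obtain ⟨y, hy⟩ := hmem
  refine ⟨LinearMap.toContinuousLinearMap y, ?_⟩
  ext1 x
  exact (congrArg (fun l => l x) hy).symm

/-- If a fixed row of `φ(1, lam, V)` annihilates the kernels of `φ(1, lam, W)` for all real `lam`,
then it is a fixed row of `φ(1, lam, W)`. -/
theorem exists_row_eq (hV : IsPotential V) (hW : IsPotential W)
    (l : EuclideanSpace ℂ (Fin N) →L[ℂ] ℂ)
    (hker : ∀ (mu : ℝ) (w : EuclideanSpace ℂ (Fin N)), mOp W mu w = 0 → l (mOp V mu w) = 0) :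
    ∃ l' : EuclideanSpace ℂ (Fin N) →L[ℂ] ℂ, ∀ lam : ℂ, l ∘L mOp V lam = l' ∘L mOp W lam := by
  have hmW := differentiable_mOp hW
  have hrow : ∀ (y : EuclideanSpace ℂ (Fin N) →L[ℂ] ℂ) {U : ℝ → Matrix (Fin N) (Fin N) ℂ},
      IsPotential U → Differentiable ℂ fun lam => y ∘L mOp U lam := fun y U hU =>
    (differentiable_const y).clm_comp (differentiable_mOp hU)
  set G : ℂ → EuclideanSpace ℂ (Fin N) →L[ℂ] ℂ := fun lam =>
    (l ∘L mOp V lam) ∘L Ring.inverse (mOp W lam) with hG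
  have hGd : ∀ w, IsUnit (mOp W w) → DifferentiableAt ℂ G w := fun w hw =>
    (hrow l hV w).clm_comp ((differentiableAt_inverse (𝕜 := ℂ) hw).comp w (hmW w))
  have hbdd : ∀ z, ∃ C, ∀ᶠ w in 𝓝[≠] z, ‖G w‖ ≤ C := by
    intro z
    by_cases hz : star z = z
    · obtain ⟨mu, rfl⟩ : ∃ mu : ℝ, z = mu := ⟨z.re, (Complex.conj_eq_iff_re.1 hz).symm⟩
      obtain ⟨C, hC⟩ := eventually_isUnit_mOp hW mu
      obtain ⟨y, hy⟩ := exists_clm_factor (A := mOp W mu) (r := l ∘L mOp V mu)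
        fun x hx => hker mu x hx
      -- Subtracting y∘M_W changes G only by the constant y, and q(μ) = 0 compensates the simple
      -- pole of the inverse.
      set q : ℂ → EuclideanSpace ℂ (Fin N) →L[ℂ] ℂ := fun lam =>
        l ∘L mOp V lam - y ∘L mOp W lam with hq
      have hq0 : q mu = 0 := by rw [hq]; exact sub_eq_zero.2 hy
      have hqd : DifferentiableAt ℂ q mu := (hrow l hV mu).sub (hrow y hW mu)
      obtain ⟨D, hD⟩ := hqd.isBigO_sub.bound
      refine ⟨‖y‖ + D * C, ?_⟩
      filter_upwards [hC, nhdsWithin_le_nhds hD, self_mem_nhdsWithin]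
        with w ⟨hw1, hw2⟩ hw3 (hw4 : w ≠ mu)
      rw [hq0, sub_zero] at hw3
      have hpos : 0 < ‖w - mu‖ := norm_pos_iff.2 (sub_ne_zero.2 hw4)
      have hGw : G w = y + q w ∘L Ring.inverse (mOp W w) := by
        have : mOp W w ∘L Ring.inverse (mOp W w) = 1 := Ring.mul_inverse_cancel _ hw1
        rw [hq, ContinuousLinearMap.sub_comp, ContinuousLinearMap.comp_assoc y, this]
        simp only [hG]
        rw [show y ∘L (1 : EuclideanSpace ℂ (Fin N) →L[ℂ] EuclideanSpace ℂ (Fin N)) = y from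
          ContinuousLinearMap.comp_id y]
        abel
      rw [hGw]
      refine (norm_add_le _ _).trans (add_le_add le_rfl ?_)
      calc ‖q w ∘L Ring.inverse (mOp W w)‖ ≤ ‖q w‖ * ‖Ring.inverse (mOp W w)‖ :=
            ContinuousLinearMap.opNorm_comp_le _ _
        _ ≤ (D * ‖w - mu‖) * (C / ‖w - mu‖) :=
            mul_le_mul hw3 hw2 (norm_nonneg _) ((norm_nonneg _).trans hw3)
        _ = D * C := by field_simp
    · have hc := (hGd z (isUnit_mOp_of_not_real hW hz)).continuousAt.norm
      exact ⟨‖G z‖ + 1, nhdsWithin_le_nhds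
        ((hc.eventually_lt continuousAt_const (by simp)).mono fun w hw => hw.le)⟩
  obtain ⟨g, hg, hgG⟩ := exists_entire_extension
    (fun z => (eventually_isUnit_mOp_nhdsNE hW z).mono hGd) hbdd
  have hVn := potentialNorm_nonneg V
  have hWn := potentialNorm_nonneg W
  have hconst := eq_of_bounded_on_squares hg
    (B := 16 * potentialNorm V + 16 * potentialNorm W + 1) (C := 16 * ‖l‖) (fun z hz hz2 => by
      have hz0 : z ≠ 0 := by rw [← norm_pos_iff]; linarith
      have hz' : 0 < ‖z‖ := norm_pos_iff.2 hz0
      have hsin : Real.exp |z.im| / 4 ≤ ‖Complex.sin z‖ :=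
        hz2.elim exp_div_four_le_norm_sin_of_cos_eq_zero exp_div_four_le_norm_sin_of_one_le
      obtain ⟨hu, hinv⟩ := norm_inverse_mOp_sq_le hW hz0 (by linarith) hsin
      have hm := norm_mOp_sq_le hV hz0 (by linarith)
      rw [hgG _ (hGd _ hu).continuousAt]
      -- The growth e^{|Im z|}/|z| of one factor cancels against the inverse growth of the other.
      calc ‖G (z ^ 2)‖ ≤ ‖l‖ * ‖mOp V (z ^ 2)‖ * ‖Ring.inverse (mOp W (z ^ 2))‖ :=
            (ContinuousLinearMap.opNorm_comp_le _ _).trans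
              (mul_le_mul_of_nonneg_right (ContinuousLinearMap.opNorm_comp_le _ _)
                (norm_nonneg _))
        _ ≤ ‖l‖ * (2 / ‖z‖ * Real.exp |z.im|) * (8 * ‖z‖ / Real.exp |z.im|) := by gcongr
        _ = 16 * ‖l‖ := by
            have := (Real.exp_pos |z.im|).ne'
            field_simp
            ring)
  refine ⟨g 0, fun lam => ?_⟩
  have hev : ∀ᶠ w in 𝓝[≠] lam, l ∘L mOp V w = g 0 ∘L mOp W w := by
    filter_upwards [eventually_isUnit_mOp_nhdsNE hW lam] with w hw
    rw [← hconst w, hgG w (hGd w hw).continuousAt, hG]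
    simp only
    rw [ContinuousLinearMap.comp_assoc]
    have : Ring.inverse (mOp W w) ∘L mOp W w = 1 := Ring.inverse_mul_cancel _ hw
    rw [this]
    rfl
  have t1 := ((hrow l hV).continuous.tendsto lam).mono_left (nhdsWithin_le_nhds (s := {lam}ᶜ))
  have t2 := ((hrow (g 0) hW).continuous.tendsto lam).mono_left
    (nhdsWithin_le_nhds (s := {lam}ᶜ))
  exact tendsto_nhds_unique (t1.congr' hev) t2

end Factorization

/-! ### The forbidden subspace -/

section Forbidden

variable {N : ℕ} {V W : ℝ → Matrix (Fin N) (Fin N) ℂ}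

theorem inner_gram_symm (hV : IsPotential V) (mu : ℂ) (a b : EuclideanSpace ℂ (Fin N)) :
    inner ℂ (op (gram V mu mu) a) b = inner ℂ a (op (gram V mu mu) b) := by
  rw [← inner_conj_symm, inner_gram hV, inner_gram hV, intervalIntegral.integral_of_le zero_le_one,
    intervalIntegral.integral_of_le zero_le_one, ← integral_conj]
  simp_rw [inner_conj_symm]

/-- The Lagrange identity with one boundary term gone. The row vanishes at λ = μ, and its difference
quotient there tends to ⟨h, G(μ, μ)w⟩. -/
theorem inner_dOp_mOp (hV : IsPotential V) {mu : ℝ} {h : EuclideanSpace ℂ (Fin N)}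
    (hh : mOp V mu h = 0) (lam : ℂ) (w : EuclideanSpace ℂ (Fin N)) :
    inner ℂ (dOp V mu h) (mOp V lam w) = (lam - mu) * inner ℂ h (op (gram V mu lam) w) := by
  have := lagrange hV mu lam h w
  have hs : star (mu : ℂ) = mu := Complex.conj_ofReal mu
  rw [hh, inner_zero_left, zero_sub, hs] at this
  linear_combination -this

theorem tendsto_inner_gram (hV : IsPotential V) (mu : ℂ) (a b : EuclideanSpace ℂ (Fin N)) :
    Tendsto (fun lam => inner ℂ a (op (gram V mu lam) b)) (𝓝[≠] mu)
      (𝓝 (inner ℂ a (op (gram V mu mu) b))) := by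
  have h : Continuous fun lam => inner ℂ a (op (gram V mu lam) b) :=
    continuous_const.inner ((continuous_gram hV mu).clm_apply continuous_const)
  exact (h.tendsto mu).mono_left nhdsWithin_le_nhds

/-- The identity gives ⟨h, G(μ, λ)h⟩ = 0 for λ ≠ μ; the limit λ → μ and positivity finish. -/
theorem eq_zero_of_mOp_of_dOp (hV : IsPotential V) {mu : ℝ} {h : EuclideanSpace ℂ (Fin N)}
    (hm : mOp V mu h = 0) (hd : dOp V mu h = 0) : h = 0 := by
  refine eq_zero_of_inner_gram_self hV (lam := mu)
    (tendsto_nhds_unique (tendsto_inner_gram hV mu h h) (tendsto_const_nhds.congr' ?_))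
  filter_upwards [self_mem_nhdsWithin] with lam (hlam : lam ≠ mu)
  have := inner_dOp_mOp hV hm lam h
  rw [hd, inner_zero_left, eq_comm, mul_eq_zero] at this
  exact (this.resolve_left (sub_ne_zero.2 hlam)).symm

/-- `φ'(1, mu)` maps the kernel of `φ(1, mu)` onto the orthogonal complement of its range. -/
theorem exists_dOp_eq (hV : IsPotential V) {mu : ℝ} {c : EuclideanSpace ℂ (Fin N)}
    (hc : ∀ w, inner ℂ c (mOp V mu w) = 0) : ∃ h, mOp V mu h = 0 ∧ dOp V mu h = c := by
  set K := LinearMap.ker (mOp V mu).toLinearMap with hK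
  set R := LinearMap.range (mOp V mu).toLinearMap with hR
  have hle : K.map (dOp V mu).toLinearMap ≤ Rᗮ := by
    rintro _ ⟨h, hh, rfl⟩
    rw [Submodule.mem_orthogonal']
    rintro _ ⟨w, rfl⟩
    have := inner_dOp_mOp hV (mu := mu) hh mu w
    rwa [sub_self, zero_mul] at this
  -- φ'(1, μ) is injective on the kernel, whose dimension is the codimension of the range.
  have hdim : Module.finrank ℂ (K.map (dOp V mu).toLinearMap) = Module.finrank ℂ Rᗮ := by
    have h1 : Module.finrank ℂ (K.map (dOp V mu).toLinearMap) = Module.finrank ℂ K := by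
      rw [← LinearMap.range_domRestrict]
      refine LinearMap.finrank_range_of_inj ((injective_iff_map_eq_zero _).2 fun x hx => ?_)
      exact Subtype.ext (eq_zero_of_mOp_of_dOp hV x.2 hx)
    have h2 := R.finrank_add_finrank_orthogonal
    have h3 := (mOp V mu).toLinearMap.finrank_range_add_finrank_ker
    rw [← hR, ← hK] at h3
    omega
  have heq := Submodule.eq_of_le_of_finrank_eq hle hdim
  have hcm : c ∈ Rᗮ := by
    rw [Submodule.mem_orthogonal']
    rintro _ ⟨w, rfl⟩
    exact hc w
  rw [← heq] at hcm
  obtain ⟨h, hh, hhc⟩ := hcm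
  exact ⟨h, hh, hhc⟩

/-- For h in E_α(V), the rigid row through φ'(1, μ)h yields k in E_α(W) with S_W k = S_V h. Only
this inclusion is needed, since the situation is symmetric in the two potentials. -/
theorem map_S_E_le (hV : IsPotential V) (hW : IsPotential W)
    (hlam : ∀ β, eigenvalue W β = eigenvalue V β) {α : ℕ}
    (hE : ∀ β : ℕ, β ≠ α → E W β = E V β) :
    (E V α).map (Matrix.toEuclideanLin (S V α)) ≤ (E W α).map (Matrix.toEuclideanLin (S W α)) := by
  rintro _ ⟨h, hh, rfl⟩
  set mu := eigenvalue V α with hmu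
  have hm : mOp V mu h = 0 := hh
  -- At ν = μ the whole row vanishes, whatever E_α(W) is; this is why the kernels need to agree only
  -- at the other eigenvalues.
  obtain ⟨l', hl'⟩ := exists_row_eq hV hW (innerSL ℂ (dOp V mu h)) fun ν w hw => by
    rw [innerSL_apply_apply]
    rcases eq_or_ne ν mu with rfl | hne
    · rw [inner_dOp_mOp hV hm, sub_self, zero_mul]
    · by_cases hw0 : w = 0
      · simp [hw0]
      have hev : ν ∈ eigenvalues W := by
        rw [mem_eigenvalues_iff hW]
        intro hu
        rw [ContinuousLinearMap.isUnit_iff_bijective] at hu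
        exact hw0 ((injective_iff_map_eq_zero (mOp W ν)).1 hu.1 _ hw)
      obtain ⟨β, rfl⟩ := exists_eigenvalue_eq hW hev
      have hβ : β ≠ α := by
        rintro rfl
        exact hne (hlam β)
      have hwE : w ∈ E W β := hw
      rw [hE β hβ] at hwE
      have hwV : mOp V (eigenvalue V β) w = 0 := hwE
      rw [hlam β, hwV, inner_zero_right]
  set c := (InnerProductSpace.toDual ℂ (EuclideanSpace ℂ (Fin N))).symm l' with hc
  have hrow : ∀ lam w, inner ℂ (dOp V mu h) (mOp V lam w) = inner ℂ c (mOp W lam w) := by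
    intro lam w
    have := congrArg (fun r => r w) (hl' lam)
    rw [hc, InnerProductSpace.toDual_symm_apply]
    simpa using this
  obtain ⟨k, hk, hkc⟩ := exists_dOp_eq hW (mu := mu) (c := c) fun w => by
    rw [← hrow, inner_dOp_mOp hV hm, sub_self, zero_mul]
  have hWmu : eigenvalue W α = mu := hlam α
  refine ⟨k, ?_, ?_⟩
  · change mOp W (eigenvalue W α) k = 0
    rw [hWmu, hk]
  have hgram : ∀ w, inner ℂ h (op (gram V mu mu) w) = inner ℂ k (op (gram W mu mu) w) := by
    intro w
    refine tendsto_nhds_unique (tendsto_inner_gram hV mu h w)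
      ((tendsto_inner_gram hW mu k w).congr' ?_)
    filter_upwards [self_mem_nhdsWithin] with lam (hne : lam ≠ mu)
    have h1 := hrow lam w
    rw [← hkc, inner_dOp_mOp hV hm, inner_dOp_mOp hW hk] at h1
    exact (mul_left_cancel₀ (sub_ne_zero.2 hne) h1).symm
  rw [S_eq_gram, S_eq_gram, hWmu]
  change op (gram W mu mu) k = op (gram V mu mu) h
  refine ext_inner_right ℂ fun w => ?_
  rw [inner_gram_symm hW, inner_gram_symm hV, hgram]

/-- A vector w of both subspaces is orthogonal to S_α w, and S_α is positive definite. -/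
theorem E_inf_F_eq_bot (hV : IsPotential V) (α : ℕ) : E V α ⊓ F V α = ⊥ := by
  rw [Submodule.eq_bot_iff]
  rintro w ⟨hwE, hwF⟩
  have h := (Submodule.mem_orthogonal _ _).1 hwF _ (Submodule.mem_map_of_mem hwE)
  refine eq_zero_of_inner_gram_self hV (lam := eigenvalue V α) ?_
  rw [← inner_gram_symm hV]
  exact h

end Forbidden

end MatrixSchrodinger

end

theorem proposition1p4 {N : ℕ} (V W : ℝ → Matrix (Fin N) (Fin N) ℂ)
    (hV : MatrixSchrodinger.IsPotential V) (hW : W ∈ MatrixSchrodinger.Iso V) (α : ℕ)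
    (hE : ∀ β : ℕ, β ≠ α → MatrixSchrodinger.E W β = MatrixSchrodinger.E V β) :
    MatrixSchrodinger.F W α = MatrixSchrodinger.F V α ∧
      MatrixSchrodinger.E W α ⊓ MatrixSchrodinger.F V α = ⊥ := by
  have hF : MatrixSchrodinger.F W α = MatrixSchrodinger.F V α :=
    congrArg (fun K : Submodule ℂ (EuclideanSpace ℂ (Fin N)) => Kᗮ) (le_antisymm
      (MatrixSchrodinger.map_S_E_le hW.1 hV (fun β => ((hW.2 β).1).symm)
        fun β hβ => (hE β hβ).symm)
      (MatrixSchrodinger.map_S_E_le hV hW.1 (fun β => (hW.2 β).1) hE))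
  exact ⟨hF, hF ▸ MatrixSchrodinger.E_inf_F_eq_bot hW.1 α⟩
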